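/- **Notation.** Write $(a)_n=a(a+1)\cdots(a+n-1)$, with $(a)_0=1$; the function $1/\Gamma$ is entire, with value $0$ at $0,-1,-2,\dots$. For $a_1,\dots,a_p,b_1,\dots,b_q\in\mathbb C$ put $$ {}_pM_q^{\xi,\eta}(w)=\sum_{n\ge0}\frac{(a_1)_n\cdots(a_p)_n}{(b_1)_n\cdots(b_q)_n}\frac{w^n}{\Gamma(\xi n+\eta)},\qquad {}_pK_q^{\xi,\eta;\nu}(w)=\sum_{n\ge0}\frac{(a_1)_n\cdots(a_p)_n}{(b_1)_n\cdots(b_q)_n}\frac{(\nu)_n}{\Gamma(\xi n+\eta)}\frac{w^n}{n!},$$ $$ {}_r\psi_s\!\left({(A_i,\alpha_i)_1^r\atop (B_j,\beta_j)_1^s};w\right)=\sum_{n\ge0}\frac{\prod_{i=1}^r\Gamma(A_i+\alpha_i n)}{\prod_{j=1}^s\Gamma(B_j+\beta_j n)}\frac{w^n}{n!}.$$ Appell's function is $F_3(a,a',b,b';c;x,y)=\sum_{m,n\ge0}\frac{(a)_m(a')_n(b)_m(b')_n}{(c)_{m+n}}\frac{x^m}{m!}\frac{y^n}{n!}$ for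 $|x|,|y|<1$, continued analytically in $y$ to $\mathbb C\setminus[1,\infty)$. For $x>0$ and $\Re(\gamma)>0$, Saigo–Maeda's right-sided fractional integral is $$(\mathcal I_{x-}^{\alpha,\alpha',\beta,\beta',\gamma}f)(x)=\frac{x^{-\alpha'}}{\Gamma(\gamma)}\int_x^\infty (t-x)^{\gamma-1}t^{-\alpha}F_3\!\left(\alpha,\alpha',\beta,\beta';\gamma;1-\tfrac xt,1-\tfrac tx\right)f(t)\,dt$$ and, with $n=\lfloor\Re(\gamma)\rfloor+1$, the corresponding fractional derivative is $$(\mathcal D_{x-}^{\alpha,\alpha',\beta,\beta',\gamma}f)(x)=(-1)^n\left(\frac{d}{dx}\right)^{n}\left(\mathcal I_{x-}^{-\alpha',-\alpha,-\beta',-\beta+n,-\gamma+n}f\right)(x).$$ **Theorem.** Let $\alpha,\alpha',\beta,\beta',\gamma,\eta,\nu,\xi,\sigma\in\mathbb C$ with $\Re(\nu)>0$, $\Re(\xi)>0$, $\Re(\gamma)>0$, let $\mu>0$, $c\in\mathbb R$, $z>0$, and let $a_1,\dots,a_p,b_1,\dots,b_q\in\mathbb C$ ($p,q\ge 0$). Assume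 that no $a_i$ and no $b_j$ is a non-positive integer, and that for every integer $k\ge0$ none of $1-\alpha-\alpha'+\gamma-\sigma+\mu k$, $1-\alpha'-\beta+\gamma-\sigma+\mu k$, $1+\beta'-\sigma+\mu k$ is a non-positive integer (so that the Gamma factors below are finite). (i) Let $f(t)=t^{\sigma-1}\,{}_pM_q^{\xi,\eta}(ct^{-\mu})$. Suppose that for all $x$ in a neighbourhood of $z$ the series ${}_pM_q^{\xi,\eta}(cx^{-\mu})$ and the integral defining $(\mathcal I_{x-}^{-\alpha',-\alpha,-\beta',-\beta+n,-\gamma+n}f)(x)$ converge absolutely. Then this fractional integral is $n$ times continuously differentiable in $x$ near $z$, the series on the right below converges absolutely, and $$\mathcal D_{z-}^{\alpha,\alpha',\beta,\beta',\gamma}\bigl(t^{\sigma-1}{}_pM_q^{\xi,\eta}(ct^{-\mu})\bigr)(z)=\frac{\prod_j\Gamma(b_j)}{\prod_i\Gamma(a_i)}\,z^{\sigma+\alpha+\alpha'-\gamma-1}$$ $$\times\,{}_{p+4}\psi_{q+4}\!\left({(a_i,1)_1^p,\ (1-\alpha-\alpha'+\gamma-\sigma,\mu),\ (1-\alpha'-\beta+\gamma-\sigma,\mu),\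 (1+\beta'-\sigma,\mu),\ (1,1)\atop (b_j,1)_1^q,\ (1-\sigma,\mu),\ (1-\alpha-\alpha'-\beta+\gamma-\sigma,\mu),\ (1-\alpha'+\beta'-\sigma,\mu),\ (\eta,\xi)};\,cz^{-\mu}\right).$$ (ii) Let $f(t)=t^{\sigma-1}\,{}_pK_q^{\xi,\eta;\nu}(ct^{-\mu})$. Under the same convergence assumptions with ${}_pK_q^{\xi,\eta;\nu}$ in place of ${}_pM_q^{\xi,\eta}$, the same regularity and convergence hold, and $$\mathcal D_{z-}^{\alpha,\alpha',\beta,\beta',\gamma}\bigl(t^{\sigma-1}{}_pK_q^{\xi,\eta;\nu}(ct^{-\mu})\bigr)(z)=\frac{\prod_j\Gamma(b_j)}{\prod_i\Gamma(a_i)}\,\frac{z^{\sigma+\alpha+\alpha'-\gamma-1}}{\Gamma(\nu)}$$ $$\times\,{}_{p+4}\psi_{q+4}\!\left({(a_i,1)_1^p,\ (1-\alpha-\alpha'+\gamma-\sigma,\mu),\ (1-\alpha'-\beta+\gamma-\sigma,\mu),\ (1+\beta'-\sigma,\mu),\ (\nu,1)\atop (b_j,1)_1^q,\ (1-\sigma,\mu),\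 (1-\alpha-\alpha'-\beta+\gamma-\sigma,\mu),\ (1-\alpha'+\beta'-\sigma,\mu),\ (\eta,\xi)};\,cz^{-\mu}\right).$$ -/

import Mathlib

open Filter Topology MeasureTheory

noncomputable section

/-- The Pochhammer symbol `(a)_n = a (a + 1) ⋯ (a + n - 1)`. -/
def pochhammerC (a : ℂ) (n : ℕ) : ℂ := (ascPochhammer ℂ n).eval a

/-- The double series
`∑_{m,n ≥ 0} (a)_m (a')_n (b)_m (b')_n / (c)_{m+n} · x^m / m! · y^n / n!`,
which defines Appell's function `F₃` for `max (|x|, |y|) < 1`. -/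
def appellF3Series (a a' b b' c x y : ℂ) : ℂ :=
  ∑' k : ℕ × ℕ,
    pochhammerC a k.1 * pochhammerC a' k.2 * pochhammerC b k.1 * pochhammerC b' k.2 /
        pochhammerC c (k.1 + k.2) *
      (x ^ k.1 / (k.1.factorial : ℂ)) * (y ^ k.2 / (k.2.factorial : ℂ))

/-- `w` is the value at `y` of the analytic continuation, along the straight segment from `0` to
`y`, of the function given near `0` by the double series in its second variable. -/
def IsAppellF3Value (a a' b b' c x y w : ℂ) : Prop :=
  ∃ f : ℂ → ℂ, AnalyticOnNhd ℂ f (segment ℝ 0 y) ∧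
    f =ᶠ[𝓝 0] appellF3Series a a' b b' c x ∧ f y = w

/-- The continuation is unique. -/
theorem IsAppellF3Value.unique {a a' b b' c x y w w' : ℂ}
    (h : IsAppellF3Value a a' b b' c x y w) (h' : IsAppellF3Value a a' b b' c x y w') :
    w = w' := by
  obtain ⟨f, hf, hf0, rfl⟩ := h
  obtain ⟨g, hg, hg0, rfl⟩ := h'
  exact hf.eqOn_of_preconnected_of_eventuallyEq hg (convex_segment 0 y).isPreconnected
    (left_mem_segment ℝ 0 y) (hf0.trans hg0.symm) (right_mem_segment ℝ 0 y)

open Classical in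
/-- Appell's function `F₃(a, a', b, b', c; x, y)` for `|x| < 1` and `y ∈ ℂ ∖ [1, ∞)`: the
principal branch, i.e. the double series for `|y| < 1`, continued analytically in `y` along the
segments issuing from `0`. The continuation is needed because the kernels of the right-sided
Saigo--Maeda operators use `y = 1 - t / x` for all `t > x > 0`, hence all `y < 0`.
(The value is `0` where there is no continuation.) -/
def appellF3 (a a' b b' c x y : ℂ) : ℂ :=
  if h : ∃ w, IsAppellF3Value a a' b b' c x y w then h.choose else 0

theorem IsAppellF3Value.appellF3_eq {a a' b b' c x y w : ℂ}
    (h : IsAppellF3Value a a' b b' c x y w) : appellF3 a a' b b' c x y = w := by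
  have hex : ∃ w, IsAppellF3Value a a' b b' c x y w := ⟨w, h⟩
  rw [appellF3, dif_pos hex]
  exact hex.choose_spec.unique h

/-- The integrand of the right-sided Saigo--Maeda fractional integral at `x`. -/
def saigoMaedaIntegrandRight (α α' β β' γ : ℂ) (f : ℝ → ℂ) (x t : ℝ) : ℂ :=
  ((t - x : ℝ) : ℂ) ^ (γ - 1) * (t : ℂ) ^ (-α) *
    appellF3 α α' β β' γ ((1 - x / t : ℝ) : ℂ) ((1 - t / x : ℝ) : ℂ) * f t

/-- The right-sided Saigo--Maeda fractional integral
`(I_{x-}^{α,α',β,β',γ} f)(x)`, for `Re γ > 0` and `x > 0`. -/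
def saigoMaedaIntegralRight (α α' β β' γ : ℂ) (f : ℝ → ℂ) (x : ℝ) : ℂ :=
  (x : ℂ) ^ (-α') / Complex.Gamma γ *
    ∫ t in Set.Ioi x, saigoMaedaIntegrandRight α α' β β' γ f x t

/-- The order of differentiation `n = ⌊Re γ⌋ + 1`. -/
def saigoMaedaOrder (γ : ℂ) : ℕ := ⌊γ.re⌋₊ + 1

/-- The function `I_{x-}^{-α',-α,-β',-β+n,-γ+n} f` whose `n`-th derivative is taken. -/
def saigoMaedaPrederivRight (α α' β β' γ : ℂ) (f : ℝ → ℂ) : ℝ → ℂ :=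
  saigoMaedaIntegralRight (-α') (-α) (-β') (-β + saigoMaedaOrder γ) (-γ + saigoMaedaOrder γ) f

/-- The integral defining `(I_{x-}^{-α',-α,-β',-β+n,-γ+n} f)(x)` converges absolutely. -/
def SaigoMaedaPrederivRightConverges (α α' β β' γ : ℂ) (f : ℝ → ℂ) (x : ℝ) : Prop :=
  IntegrableOn
    (saigoMaedaIntegrandRight (-α') (-α) (-β') (-β + saigoMaedaOrder γ)
      (-γ + saigoMaedaOrder γ) f x)
    (Set.Ioi x)

/-- The right-sided Saigo--Maeda fractional derivative `(D_{x-}^{α,α',β,β',γ} f)(x)`, for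
`Re γ > 0` and `x > 0`. -/
def saigoMaedaDerivRight (α α' β β' γ : ℂ) (f : ℝ → ℂ) (x : ℝ) : ℂ :=
  (-1) ^ saigoMaedaOrder γ *
    iteratedDeriv (saigoMaedaOrder γ) (saigoMaedaPrederivRight α α' β β' γ f) x

/-- The `n`-th term of the generalized `M`-series. Since `Complex.Gamma` vanishes at its poles,
dividing by it agrees with multiplying by the entire function `1 / Γ`. -/
def mSeriesTerm {p q : ℕ} (ξ η : ℂ) (a : Fin p → ℂ) (b : Fin q → ℂ) (z : ℂ) (n : ℕ) : ℂ :=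
  (∏ i, pochhammerC (a i) n) / (∏ j, pochhammerC (b j) n) *
    (z ^ n / Complex.Gamma (ξ * n + η))

/-- The generalized `M`-series `pM_q^{ξ,η}(a; b; z)`. -/
def mSeries {p q : ℕ} (ξ η : ℂ) (a : Fin p → ℂ) (b : Fin q → ℂ) (z : ℂ) : ℂ :=
  ∑' n : ℕ, mSeriesTerm ξ η a b z n

/-- The `n`-th term of the `K`-function. -/
def kFunctionTerm {p q : ℕ} (ξ η ν : ℂ) (a : Fin p → ℂ) (b : Fin q → ℂ) (z : ℂ) (n : ℕ) : ℂ :=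
  (∏ i, pochhammerC (a i) n) / (∏ j, pochhammerC (b j) n) *
    (pochhammerC ν n / Complex.Gamma (ξ * n + η)) * (z ^ n / (n.factorial : ℂ))

/-- The `K`-function `pK_q^{ξ,η;ν}(a; b; z)`. -/
def kFunction {p q : ℕ} (ξ η ν : ℂ) (a : Fin p → ℂ) (b : Fin q → ℂ) (z : ℂ) : ℂ :=
  ∑' n : ℕ, kFunctionTerm ξ η ν a b z n

/-- The `n`-th term of the Fox--Wright series with upper parameters `A i = (a_i, α_i)` and lower
parameters `B j = (b_j, β_j)`. As above, `1 / Γ` is zero at the poles of `Γ`. -/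
def foxWrightTerm {p q : ℕ} (A : Fin p → ℂ × ℂ) (B : Fin q → ℂ × ℂ) (z : ℂ) (n : ℕ) : ℂ :=
  (∏ i, Complex.Gamma ((A i).1 + (A i).2 * n)) / (∏ j, Complex.Gamma ((B j).1 + (B j).2 * n)) *
    (z ^ n / (n.factorial : ℂ))

/-- The generalized Fox--Wright psi function. -/
def foxWright {p q : ℕ} (A : Fin p → ℂ × ℂ) (B : Fin q → ℂ × ℂ) (z : ℂ) : ℂ :=
  ∑' n : ℕ, foxWrightTerm A B z n

/-- The upper parameters `(a_i, 1)_1^p, (1-α-α'+γ-σ, μ), (1-α'-β+γ-σ, μ), (1+β'-σ, μ), (ν, 1)`. -/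
def derivRightUpper {p : ℕ} (a : Fin p → ℂ) (α α' β β' γ σ ν : ℂ) (μ : ℝ) :
    Fin (p + 4) → ℂ × ℂ :=
  Fin.append (fun i => (a i, 1))
    ![(1 - α - α' + γ - σ, (μ : ℂ)), (1 - α' - β + γ - σ, (μ : ℂ)), (1 + β' - σ, (μ : ℂ)), (ν, 1)]

/-- The lower parameters
`(b_j, 1)_1^q, (1-σ, μ), (1-α-α'-β+γ-σ, μ), (1-α'+β'-σ, μ), (η, ξ)`. -/
def derivRightLower {q : ℕ} (b : Fin q → ℂ) (α α' β β' γ σ η ξ : ℂ) (μ : ℝ) :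
    Fin (q + 4) → ℂ × ℂ :=
  Fin.append (fun j => (b j, 1))
    ![(1 - σ, (μ : ℂ)), (1 - α - α' - β + γ - σ, (μ : ℂ)), (1 - α' + β' - σ, (μ : ℂ)), (η, ξ)]

end

/-! Everything rests on the action of the operator on one power. The substitution t = xu turns the
fractional integral of t^s into a power of x times a constant, and this constant is a Mellin
transform of `saigoKernel` over (1, ∞). In the kernel, F₃ is needed at (1 - 1/u, 1 - u), outside its
double series. Pfaff's transformation in the second variable continues it to Re y < 1/2 as a double
power series in x and v = y/(y - 1) (`isAppellF3Value`), and on the ray x and v are both 1 - 1/u.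
Termwise integration gives Beta functions, and Gauss's theorem, applied to each of the two
summations, leaves a quotient of Gamma functions (`integral_saigoKernel`). That computation requires
strong decay of the power; the identity theorem and a limit at the boundary carry the formula to
every exponent with an absolutely convergent integral (`integral_saigoKernel_of_integrableOn`).

For a series, absolute convergence is assumed only for the integral of the whole sum. As t → ∞ the
variable t^(-μ) tends to 0, so the sum is comparable to its first nonzero term; hence that term is
integrable against the kernel, and so are all later ones, with a common bound
(`integrableOn_saigoKernel_mul_term`). This permits termwise integration, and the function to be
differentiated is a series ∑ e_k x^(S - μk) that converges for all x beyond some x₀ < z and may be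
differentiated termwise. The n derivatives contribute (P)_n with P = μk - S, and (P)_n / Γ(P + n) =
1/Γ(P), so n drops out and `derivRightFactor` remains. Finally the M-series is the K-function with ν
= 1. -/

/-! ### Pochhammer symbols. -/

theorem pochhammerC_zero (a : ℂ) : pochhammerC a 0 = 1 := by simp [pochhammerC]

theorem pochhammerC_succ (a : ℂ) (n : ℕ) :
    pochhammerC a (n + 1) = pochhammerC a n * (a + n) := by
  simp [pochhammerC, ascPochhammer_succ_eval]

theorem pochhammerC_add (a : ℂ) (m n : ℕ) :
    pochhammerC a (m + n) = pochhammerC a m * pochhammerC (a + m) n := by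
  induction n with
  | zero => simp [pochhammerC_zero]
  | succ n ih =>
    rw [← add_assoc, pochhammerC_succ, ih, pochhammerC_succ]
    push_cast
    ring

theorem pochhammerC_succ_left (a : ℂ) (n : ℕ) :
    pochhammerC a (n + 1) = a * pochhammerC (a + 1) n := by
  rw [add_comm n 1, pochhammerC_add, show (1 : ℕ) = 0 + 1 from rfl, pochhammerC_succ]
  simp [pochhammerC_zero]

theorem pochhammerC_one (n : ℕ) : pochhammerC 1 n = (n.factorial : ℂ) := by
  induction n with
  | zero => simp [pochhammerC_zero]
  | succ n ih => rw [pochhammerC_succ, ih, Nat.factorial_succ]; push_cast; ring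

theorem re_add_natCast_pos {c : ℂ} (hc : 0 < c.re) (n : ℕ) : 0 < (c + n).re := by
  simp only [Complex.add_re, Complex.natCast_re]
  positivity

theorem re_le_re_add_natCast (c : ℂ) (m : ℕ) : c.re ≤ (c + m).re := by simp

theorem add_natCast_ne_zero {c : ℂ} (hc : 0 < c.re) (n : ℕ) : c + n ≠ 0 := fun h => by
  have := re_add_natCast_pos hc n
  simp [h] at this

theorem pochhammerC_ne_zero {c : ℂ} (hc : 0 < c.re) (n : ℕ) : pochhammerC c n ≠ 0 := by
  induction n with
  | zero => simp [pochhammerC_zero]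
  | succ n ih =>
    rw [pochhammerC_succ]
    exact mul_ne_zero ih (add_natCast_ne_zero hc n)

theorem Gamma_add_natCast {a : ℂ} (ha : ∀ k : ℕ, a ≠ -(k : ℂ)) (n : ℕ) :
    Complex.Gamma (a + n) = pochhammerC a n * Complex.Gamma a := by
  induction n with
  | zero => simp [pochhammerC_zero]
  | succ n ih =>
    have h : a + n ≠ 0 := fun h => ha n (eq_neg_of_add_eq_zero_left h)
    rw [pochhammerC_succ, Nat.cast_succ, ← add_assoc, Complex.Gamma_add_one _ h, ih]
    ring

theorem ne_neg_natCast_of_re_pos {a : ℂ} (ha : 0 < a.re) (k : ℕ) : a ≠ -(k : ℂ) := by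
  rintro rfl
  simp at ha
  linarith [(Nat.cast_nonneg k : (0 : ℝ) ≤ k)]

/-! ### Gauss's coefficients, with bounds uniform in the lower parameter. -/

/-- The `n`-th coefficient of Gauss's hypergeometric series `₂F₁(a, b; c; ·)`. -/
noncomputable def gaussCoeff (a b c : ℂ) (n : ℕ) : ℂ :=
  pochhammerC a n * pochhammerC b n / (pochhammerC c n * (n.factorial : ℂ))

theorem gaussCoeff_zero (a b c : ℂ) : gaussCoeff a b c 0 = 1 := by
  simp [gaussCoeff, pochhammerC_zero]

theorem gaussCoeff_succ (a b c : ℂ) (n : ℕ) :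
    gaussCoeff a b c (n + 1) =
      gaussCoeff a b c n * ((a + n) * (b + n) / ((c + n) * (n + 1))) := by
  simp only [gaussCoeff, pochhammerC_succ, Nat.factorial_succ]
  push_cast
  rw [div_mul_div_comm]
  congr 1 <;> ring

theorem succ_add_choose_mul (n e : ℕ) :
    ((n + 1 + e).choose e : ℝ) * (n + 1) = ((n + e).choose e : ℝ) * (e + 1 + n) := by
  have h := Nat.add_one_mul_choose_eq (n + e) n
  have h1 : (n + e).choose n = (n + e).choose e := Nat.choose_symm_add
  have h2 : (n + e + 1).choose (n + 1) = (n + 1 + e).choose e := by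
    rw [show n + e + 1 = (n + 1) + e by ring]; exact Nat.choose_symm_add
  rw [h1, h2] at h
  have h' := congrArg (Nat.cast : ℕ → ℝ) h
  push_cast at h'
  linarith

/-- The hypothesis compares consecutive quotients: those of the binomial coefficients are (e + 1 +
n)/(n + 1). -/
theorem norm_gaussCoeff_le {a b c : ℂ} (hc : 0 < c.re) (e : ℕ)
    (h : ∀ j : ℕ, ‖(a + j) * (b + j)‖ ≤ (e + 1 + j) * ‖c + j‖) (n : ℕ) :
    ‖gaussCoeff a b c n‖ ≤ ((n + e).choose e : ℝ) := by
  induction n with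
  | zero => simp [gaussCoeff_zero]
  | succ n ih =>
    have hpos : 0 < ‖c + n‖ := norm_pos_iff.2 (add_natCast_ne_zero hc n)
    have hn : (0 : ℝ) < n + 1 := by positivity
    have hn' : ‖((n : ℂ) + 1)‖ = n + 1 := by
      have : ((n : ℂ) + 1) = ((n + 1 : ℝ) : ℂ) := by push_cast; ring
      rw [this, Complex.norm_real, Real.norm_of_nonneg hn.le]
    rw [gaussCoeff_succ, norm_mul, norm_div, norm_mul (c + n), hn']
    have h1 : ‖(a + n) * (b + n)‖ / (‖c + n‖ * (n + 1)) ≤ (e + 1 + n) / (n + 1) := by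
      rw [div_le_div_iff₀ (by positivity) hn]
      nlinarith [h n]
    calc _ ≤ ((n + e).choose e : ℝ) * ((e + 1 + n) / (n + 1)) := by gcongr
      _ = _ := by
        rw [← mul_div_assoc, ← succ_add_choose_mul, mul_div_cancel_right₀ _ hn.ne']

theorem add_re_le_norm_add {c : ℂ} {g : ℝ} (hgc : g ≤ c.re) (j : ℕ) : g + j ≤ ‖c + j‖ := by
  have := Complex.re_le_norm (c + j)
  simp at this
  linarith

/-- The point is that e does not depend on c. In the double series for F₃ the inner lower parameter
is c + m, and after Pfaff's transformation an upper parameter c + m - b' moves with it; one e has to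
serve all m. -/
theorem exists_gaussCoeff_bound (a b : ℂ) {g : ℝ} (hg : 0 < g) :
    ∃ e : ℕ, ∀ c : ℂ, g ≤ c.re →
      (∀ n, ‖gaussCoeff a b c n‖ ≤ ((n + e).choose e : ℝ)) ∧
      (∀ n, ‖gaussCoeff a (c - b) c n‖ ≤ ((n + e).choose e : ℝ)) := by
  -- The last summand w satisfies w * g = ‖a‖ * ‖b‖, which absorbs the constant term of the product
  -- of the two upper factors.
  obtain ⟨e, he⟩ := exists_nat_ge (‖a‖ + ‖b‖ + ‖a‖ * ‖b‖ / g)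
  refine ⟨e, fun c hgc => ⟨norm_gaussCoeff_le (hg.trans_le hgc) e fun j => ?_,
    norm_gaussCoeff_le (hg.trans_le hgc) e fun j => ?_⟩⟩
  all_goals
    have hN := add_re_le_norm_add hgc j
    set N := ‖c + j‖
    have hj : (0 : ℝ) ≤ j := Nat.cast_nonneg j
    have ha := norm_nonneg a
    have hb := norm_nonneg b
    have ha' : ‖a + j‖ ≤ ‖a‖ + j := by simpa using norm_add_le a (j : ℂ)
    set w := ‖a‖ * ‖b‖ / g with hw
    have hw0 : 0 ≤ w := by positivity
    have hwg : w * g = ‖a‖ * ‖b‖ := by rw [hw]; field_simp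
    rw [norm_mul]
  · have hb' : ‖b + j‖ ≤ ‖b‖ + j := by simpa using norm_add_le b (j : ℂ)
    calc _ ≤ (‖a‖ + j) * (‖b‖ + j) := by gcongr
      _ ≤ (‖a‖ + ‖b‖ + w + j) * (g + j) := by
        nlinarith [mul_nonneg ha hg.le, mul_nonneg hb hg.le, mul_nonneg hw0 hj]
      _ ≤ _ := mul_le_mul (by linarith) hN (by positivity) (by positivity)
  · have hb' : ‖c - b + j‖ ≤ N + ‖b‖ := by
      rw [show c - b + j = (c + j) - b by ring]; exact norm_sub_le _ _
    calc _ ≤ (‖a‖ + j) * (N + ‖b‖) := by gcongr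
      _ ≤ (‖a‖ + j) * N + (‖b‖ + w) * (g + j) := by
        nlinarith [mul_nonneg hb hg.le, mul_nonneg hw0 hj]
      _ ≤ (‖a‖ + j) * N + (‖b‖ + w) * N := by gcongr
      _ = (‖a‖ + ‖b‖ + w + j) * N := by ring
      _ ≤ _ := mul_le_mul_of_nonneg_right (by linarith) (norm_nonneg _)

theorem choose_add_le_two_pow (n e : ℕ) : ((n + e).choose e : ℝ) ≤ 2 ^ e * 2 ^ n := by
  have : (n + e).choose e ≤ 2 ^ (n + e) := Nat.choose_le_two_pow _ _
  calc ((n + e).choose e : ℝ) ≤ 2 ^ (n + e) := by exact_mod_cast this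
    _ = _ := by rw [pow_add, mul_comm]

/-! ### The Chu–Vandermonde identity and Pfaff's transformation near the origin. -/

/-- The Chu--Vandermonde identity. -/
theorem sum_choose_mul_pochhammerC_div (N : ℕ) {c d : ℂ} (hc : 0 < c.re) :
    ∑ k ∈ Finset.range (N + 1),
      (N.choose k : ℂ) * ((-1) ^ k * (pochhammerC d k / pochhammerC c k)) =
      pochhammerC (c - d) N / pochhammerC c N := by
  induction N generalizing c d with
  | zero => simp [pochhammerC_zero]
  | succ N ih =>
    have hc1 : 0 < (c + 1).re := by simpa using re_add_natCast_pos hc 1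
    rw [Finset.sum_choose_succ_mul (fun k _ => (-1 : ℂ) ^ k * (pochhammerC d k / pochhammerC c k)),
      ih hc]
    -- By Pascal's rule the sum for N + 1 splits into two sums for N; the second has both c and d
    -- raised by 1, so c - d is unchanged and the induction hypothesis applies to both.
    have hshift : ∀ k ∈ Finset.range (N + 1),
        (N.choose k : ℂ) * ((-1) ^ (k + 1) * (pochhammerC d (k + 1) / pochhammerC c (k + 1))) =
        -(d / c) * ((N.choose k : ℂ) *
          ((-1) ^ k * (pochhammerC (d + 1) k / pochhammerC (c + 1) k))) := by
      intro k _
      rw [pochhammerC_succ_left, pochhammerC_succ_left, mul_div_mul_comm]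
      ring
    rw [Finset.sum_congr rfl hshift, ← Finset.mul_sum, ih hc1]
    have h0 : c ≠ 0 := by simpa using add_natCast_ne_zero hc 0
    have hN := add_natCast_ne_zero hc N
    have hp := pochhammerC_ne_zero hc N
    have hp1 := pochhammerC_ne_zero hc1 N
    have key : c * pochhammerC (c + 1) N = pochhammerC c N * (c + N) := by
      rw [← pochhammerC_succ_left, pochhammerC_succ]
    have e1 : d / c * (pochhammerC (c - d) N / pochhammerC (c + 1) N) =
        d * pochhammerC (c - d) N / (pochhammerC c N * (c + N)) := by
      rw [← key, div_mul_div_comm]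
    rw [show c + 1 - (d + 1) = c - d by ring, neg_mul, e1, pochhammerC_succ, pochhammerC_succ]
    field_simp
    ring

theorem hasSum_pochhammerC_mul_pow (a : ℂ) {y : ℂ} (hy : ‖y‖ < 1) :
    HasSum (fun n => pochhammerC a n / (n.factorial : ℂ) * y ^ n) ((1 - y) ^ (-a)) := by
  have h := (Complex.one_div_one_sub_cpow_hasFPowerSeriesOnBall_zero a).hasSum (y := y)
    (by simpa [enorm_eq_nnnorm, ← NNReal.coe_lt_coe] using hy)
  have hm (n : ℕ) : Ring.choose (a + n - 1) n = pochhammerC a n / (n.factorial : ℂ) := by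
    have h1 := Ring.factorial_nsmul_multichoose_eq_ascPochhammer a n
    rw [Ring.choose, show a + n - 1 - n + 1 = a by ring,
      eq_div_iff (by exact_mod_cast n.factorial_ne_zero), pochhammerC]
    rw [Polynomial.ascPochhammer_smeval_eq_eval] at h1
    rw [← h1, nsmul_eq_mul, mul_comm]
  rw [Complex.cpow_neg]
  simpa [hm, mul_comm] using h

/-- The double series which mediates between both sides of Pfaff's transformation. -/
noncomputable def pfaffTerm (a b c y : ℂ) (p : ℕ × ℕ) : ℂ :=
  gaussCoeff a 1 1 (p.1 + p.2) * gaussCoeff 1 (c - b) c p.1 *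
    (((p.1 + p.2).choose p.1 : ℂ) * (-1) ^ p.1 * y ^ (p.1 + p.2))

theorem gaussCoeff_one_one (a : ℂ) (n : ℕ) :
    gaussCoeff a 1 1 n = pochhammerC a n / (n.factorial : ℂ) := by
  have : (n.factorial : ℂ) ≠ 0 := by exact_mod_cast n.factorial_ne_zero
  rw [gaussCoeff, pochhammerC_one]
  field_simp

theorem gaussCoeff_one_left (b c : ℂ) (n : ℕ) :
    gaussCoeff 1 b c n = pochhammerC b n / pochhammerC c n := by
  have : (n.factorial : ℂ) ≠ 0 := by exact_mod_cast n.factorial_ne_zero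
  rw [gaussCoeff, pochhammerC_one, mul_comm, mul_div_mul_right _ _ this]

theorem summable_pfaffTerm (a b : ℂ) {c y : ℂ} (hc : 0 < c.re) (hy : ‖y‖ < 1 / 8) :
    Summable (pfaffTerm a b c y) := by
  obtain ⟨e₁, h₁⟩ := exists_gaussCoeff_bound a 1 one_pos
  obtain ⟨e₂, h₂⟩ := exists_gaussCoeff_bound 1 b hc
  -- Each of the two Gauss coefficients and the binomial coefficient costs at most a factor 2 ^ (k +
  -- l), up to constants; hence 8 = 2 * 2 * 2.
  have hr : 0 ≤ 8 * ‖y‖ := by positivity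
  have hs := summable_geometric_of_lt_one hr (by linarith)
  have hs2 := (hs.mul_of_nonneg hs (fun n => pow_nonneg hr n) fun n => pow_nonneg hr n).mul_left
    ((2 : ℝ) ^ e₁ * 2 ^ e₂)
  refine Summable.of_norm_bounded hs2 fun ⟨k, l⟩ => ?_
  have b1 := ((h₁ 1 (by simp)).1 (k + l)).trans (choose_add_le_two_pow _ _)
  have b2 := ((h₂ c le_rfl).2 k).trans (choose_add_le_two_pow _ _)
  have b3 : ((k + l).choose k : ℝ) ≤ 2 ^ (k + l) := by
    exact_mod_cast Nat.choose_le_two_pow _ _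
  have b4 : (2 : ℝ) ^ k ≤ 2 ^ (k + l) := pow_le_pow_right₀ (by norm_num) (by lia)
  simp only [pfaffTerm, norm_mul, norm_pow, norm_neg, norm_one, one_pow, mul_one,
    Complex.norm_natCast]
  calc _ ≤ (2 ^ e₁ * 2 ^ (k + l)) * (2 ^ e₂ * 2 ^ (k + l)) * (2 ^ (k + l) * ‖y‖ ^ (k + l)) := by
        gcongr
        exact b2.trans (by gcongr)
    _ = 2 ^ e₁ * 2 ^ e₂ * ((2 * 2 * 2 * ‖y‖) ^ (k + l)) := by
      simp only [mul_pow]; ring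
    _ = _ := by rw [pow_add]; norm_num

theorem natCast_choose_add (k l : ℕ) :
    ((k + l).choose k : ℂ) = ((k + l).factorial : ℂ) / ((k.factorial : ℂ) * (l.factorial : ℂ)) := by
  rw [Nat.cast_choose ℂ (Nat.le_add_right k l), Nat.add_sub_cancel_left]

/-- Pfaff's transformation of `₂F₁`, near the origin. -/
theorem pfaff (a b : ℂ) {c y : ℂ} (hc : 0 < c.re) (hy : ‖y‖ < 1 / 8) :
    (1 - y) ^ (-a) * ∑' k, gaussCoeff a (c - b) c k * (y / (y - 1)) ^ k =
      ∑' n, gaussCoeff a b c n * y ^ n := by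
  have hs := summable_pfaffTerm a b hc hy
  have hy1 : 1 - y ≠ 0 := fun h => by
    rw [← sub_eq_zero.1 h] at hy
    norm_num at hy
  -- For fixed k the sum over l is the binomial series with exponent -(a + k); it produces the
  -- powers of y / (y - 1).
  have fiber (k : ℕ) : HasSum (fun l => pfaffTerm a b c y (k, l))
      ((1 - y) ^ (-a) * (gaussCoeff a (c - b) c k * (y / (y - 1)) ^ k)) := by
    have h := (hasSum_pochhammerC_mul_pow (a + k) (hy.trans (by norm_num))).mul_left
      (gaussCoeff a (c - b) c k * (-y) ^ k)
    have e1 : (fun l => pfaffTerm a b c y (k, l)) = fun l => gaussCoeff a (c - b) c k * (-y) ^ k *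
        (pochhammerC (a + k) l / (l.factorial : ℂ) * y ^ l) := by
      funext l
      have hk : (k.factorial : ℂ) ≠ 0 := by exact_mod_cast k.factorial_ne_zero
      have hkl : ((k + l).factorial : ℂ) ≠ 0 := by exact_mod_cast (k + l).factorial_ne_zero
      have hl : (l.factorial : ℂ) ≠ 0 := by exact_mod_cast l.factorial_ne_zero
      have hck := pochhammerC_ne_zero hc k
      simp only [pfaffTerm, gaussCoeff_one_one, gaussCoeff_one_left, natCast_choose_add,
        pochhammerC_add, pow_add, neg_pow y k]
      rw [gaussCoeff]
      field_simp
    have e2 : (1 - y) ^ (-a) * (gaussCoeff a (c - b) c k * (y / (y - 1)) ^ k) =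
        gaussCoeff a (c - b) c k * (-y) ^ k * (1 - y) ^ (-(a + k)) := by
      rw [neg_add, Complex.cpow_add _ _ hy1, Complex.cpow_neg _ (k : ℂ), Complex.cpow_natCast,
        show y - 1 = -(1 - y) by ring, div_neg, neg_pow, neg_pow (y), div_pow]
      ring
    rw [e1, e2]
    exact h
  -- Along an antidiagonal, Chu–Vandermonde with d = c - b turns the alternating sum into (b)_n /
  -- (c)_n.
  have anti (n : ℕ) : ∑ p ∈ Finset.HasAntidiagonal.antidiagonal n, pfaffTerm a b c y p =
      gaussCoeff a b c n * y ^ n := by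
    rw [Finset.Nat.sum_antidiagonal_eq_sum_range_succ_mk]
    have h := sum_choose_mul_pochhammerC_div n (d := c - b) hc
    rw [sub_sub_cancel] at h
    have : gaussCoeff a b c n * y ^ n =
        gaussCoeff a 1 1 n * y ^ n * (pochhammerC b n / pochhammerC c n) := by
      have hn : (n.factorial : ℂ) ≠ 0 := by exact_mod_cast n.factorial_ne_zero
      have hcn := pochhammerC_ne_zero hc n
      rw [gaussCoeff_one_one, gaussCoeff]
      field_simp
    rw [this, ← h, Finset.mul_sum]
    refine Finset.sum_congr rfl fun k hk => ?_
    have : k + (n - k) = n := by simp at hk; lia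
    simp only [pfaffTerm, this, gaussCoeff_one_left]
    ring
  rw [← tsum_mul_left]
  have h1 : ∑' p, pfaffTerm a b c y p = _ := hs.tsum_prod
  simp_rw [fun k => (fiber k).tsum_eq] at h1
  have h2 := ((Finset.HasAntidiagonal.sigmaAntidiagonalEquivProd (A := ℕ)).summable_iff.2
    hs).tsum_sigma
  rw [← h1, ← (Finset.HasAntidiagonal.sigmaAntidiagonalEquivProd (A := ℕ)).tsum_eq]
  refine h2.trans (tsum_congr fun n => ?_)
  rw [← anti, tsum_fintype, Finset.univ_eq_attach]
  exact Finset.sum_attach (Finset.HasAntidiagonal.antidiagonal n) (pfaffTerm a b c y)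

/-! ### Continuation of F₃ to the half-plane Re y < 1/2. -/

theorem summable_choose_mul_pow (e : ℕ) {r : ℝ} (h0 : 0 ≤ r) (h1 : r < 1) :
    Summable fun n => ((n + e).choose e : ℝ) * r ^ n :=
  summable_choose_mul_geometric_of_norm_lt_one e (by rwa [Real.norm_of_nonneg h0])

theorem summable_choose_mul_pow_prod (e₁ e₂ : ℕ) {r s : ℝ} (hr0 : 0 ≤ r) (hr1 : r < 1)
    (hs0 : 0 ≤ s) (hs1 : s < 1) :
    Summable fun p : ℕ × ℕ => (((p.1 + e₁).choose e₁ : ℝ) * r ^ p.1) *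
      (((p.2 + e₂).choose e₂ : ℝ) * s ^ p.2) :=
  (summable_choose_mul_pow e₁ hr0 hr1).mul_of_nonneg (summable_choose_mul_pow e₂ hs0 hs1)
    (fun _ => by positivity) (fun _ => by positivity)

/-- The coefficient of `x^m v^k` in `(1 - y)^{a'} F₃(a, a', b, b'; c; x, y)`, where
`v = y / (y - 1)`. -/
noncomputable def appellPfaffCoeff (a a' b b' c : ℂ) (p : ℕ × ℕ) : ℂ :=
  gaussCoeff a b c p.1 * gaussCoeff a' (c + p.1 - b') (c + p.1) p.2

theorem exists_appellPfaffCoeff_bound (a a' b b' : ℂ) {c : ℂ} (hc : 0 < c.re) :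
    ∃ e₁ e₂ : ℕ, ∀ p : ℕ × ℕ, ‖appellPfaffCoeff a a' b b' c p‖ ≤
      ((p.1 + e₁).choose e₁ : ℝ) * ((p.2 + e₂).choose e₂ : ℝ) := by
  obtain ⟨e₁, h₁⟩ := exists_gaussCoeff_bound a b hc
  obtain ⟨e₂, h₂⟩ := exists_gaussCoeff_bound a' b' hc
  refine ⟨e₁, e₂, fun p => ?_⟩
  rw [appellPfaffCoeff, norm_mul]
  exact mul_le_mul ((h₁ c le_rfl).1 _) ((h₂ _ (re_le_re_add_natCast c p.1)).2 _)
    (norm_nonneg _) (by positivity)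

theorem summable_appellPfaffCoeff (a a' b b' : ℂ) {c x v : ℂ} (hc : 0 < c.re) (hx : ‖x‖ < 1)
    (hv : ‖v‖ < 1) :
    Summable fun p : ℕ × ℕ => appellPfaffCoeff a a' b b' c p * (x ^ p.1 * v ^ p.2) := by
  obtain ⟨e₁, e₂, h⟩ := exists_appellPfaffCoeff_bound a a' b b' hc
  refine Summable.of_norm_bounded (summable_choose_mul_pow_prod e₁ e₂ (norm_nonneg x) hx
    (norm_nonneg v) hv) fun p => ?_
  rw [norm_mul, norm_mul, norm_pow, norm_pow]
  calc _ ≤ ((p.1 + e₁).choose e₁ : ℝ) * ((p.2 + e₂).choose e₂ : ℝ) *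
        (‖x‖ ^ p.1 * ‖v‖ ^ p.2) := by gcongr; exact h p
    _ = _ := by ring

theorem norm_div_sub_one_lt_one {y : ℂ} (hy : y.re < 1 / 2) : ‖y / (y - 1)‖ < 1 := by
  have h1 : y - 1 ≠ 0 := fun h => by
    rw [sub_eq_zero.1 h] at hy
    norm_num at hy
  rw [norm_div, div_lt_one (norm_pos_iff.2 h1)]
  refine lt_of_pow_lt_pow_left₀ 2 (norm_nonneg _) ?_
  rw [Complex.sq_norm, Complex.sq_norm, Complex.normSq_apply, Complex.normSq_apply]
  simp
  nlinarith

theorem differentiableOn_tsum_appellPfaffCoeff (a a' b b' : ℂ) {c x : ℂ} (hc : 0 < c.re)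
    (hx : ‖x‖ < 1) :
    DifferentiableOn ℂ
      (fun v => ∑' p : ℕ × ℕ, appellPfaffCoeff a a' b b' c p * (x ^ p.1 * v ^ p.2))
      (Metric.ball 0 1) := by
  obtain ⟨e₁, e₂, h⟩ := exists_appellPfaffCoeff_bound a a' b b' hc
  intro v hv
  obtain ⟨r, hvr, hr⟩ := exists_between (mem_ball_zero_iff.1 hv)
  have hr0 : 0 ≤ r := (norm_nonneg v).trans hvr.le
  refine ((Complex.differentiableOn_tsum_of_summable_norm
    (summable_choose_mul_pow_prod e₁ e₂ (norm_nonneg x) hx hr0 hr)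
    (fun p => ?_) Metric.isOpen_ball fun p w hw => ?_).differentiableAt
    (Metric.isOpen_ball.mem_nhds (mem_ball_zero_iff.2 hvr))).differentiableWithinAt
  · fun_prop
  · have hw' := (mem_ball_zero_iff.1 hw).le
    rw [norm_mul, norm_mul, norm_pow, norm_pow]
    calc _ ≤ ((p.1 + e₁).choose e₁ : ℝ) * ((p.2 + e₂).choose e₂ : ℝ) *
          (‖x‖ ^ p.1 * r ^ p.2) := by gcongr; exact h p
      _ = _ := by ring

theorem appellF3Series_eq_tsum (a a' b b' : ℂ) {c x y : ℂ} (hc : 0 < c.re) (hx : ‖x‖ < 1)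
    (hy : ‖y‖ < 1) :
    appellF3Series a a' b b' c x y =
      ∑' m, gaussCoeff a b c m * x ^ m * ∑' n, gaussCoeff a' b' (c + m) n * y ^ n := by
  have h0 (k : ℕ × ℕ) : pochhammerC a k.1 * pochhammerC a' k.2 * pochhammerC b k.1 *
      pochhammerC b' k.2 / pochhammerC c (k.1 + k.2) *
      (x ^ k.1 / (k.1.factorial : ℂ)) * (y ^ k.2 / (k.2.factorial : ℂ)) =
      gaussCoeff a b c k.1 * x ^ k.1 * (gaussCoeff a' b' (c + k.1) k.2 * y ^ k.2) := by
    simp only [gaussCoeff, pochhammerC_add, div_eq_mul_inv, mul_inv]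
    ring
  have hs : Summable fun k : ℕ × ℕ =>
      gaussCoeff a b c k.1 * x ^ k.1 * (gaussCoeff a' b' (c + k.1) k.2 * y ^ k.2) := by
    obtain ⟨e₁, h₁⟩ := exists_gaussCoeff_bound a b hc
    obtain ⟨e₂, h₂⟩ := exists_gaussCoeff_bound a' b' hc
    refine Summable.of_norm_bounded (summable_choose_mul_pow_prod e₁ e₂ (norm_nonneg x) hx
      (norm_nonneg y) hy) fun p => ?_
    simp only [norm_mul, norm_pow]
    gcongr
    · exact (h₁ c le_rfl).1 _
    · exact (h₂ _ (re_le_re_add_natCast c p.1)).1 _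
  rw [appellF3Series]
  simp_rw [h0]
  rw [hs.tsum_prod]
  simp_rw [tsum_mul_left]

/-- Pfaff's transformation is applied to the inner series for each m. It is needed only near y = 0,
to identify the germ: the new series converges for |y/(y - 1)| < 1, that is, on a half-plane, which
contains the segment from 0 to y. -/
theorem isAppellF3Value (a a' b b' : ℂ) {c x y : ℂ} (hc : 0 < c.re) (hx : ‖x‖ < 1)
    (hy : y.re < 1 / 2) :
    IsAppellF3Value a a' b b' c x y ((1 - y) ^ (-a') *
      ∑' p : ℕ × ℕ, appellPfaffCoeff a a' b b' c p * (x ^ p.1 * (y / (y - 1)) ^ p.2)) := by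
  have hopen : IsOpen {w : ℂ | w.re < 1 / 2} := isOpen_lt Complex.continuous_re continuous_const
  have hne (w : ℂ) (hw : w.re < 1 / 2) : w - 1 ≠ 0 := fun h => by
    rw [sub_eq_zero.1 h] at hw
    norm_num at hw
  refine ⟨fun w => (1 - w) ^ (-a') *
      ∑' p : ℕ × ℕ, appellPfaffCoeff a a' b b' c p * (x ^ p.1 * (w / (w - 1)) ^ p.2), ?_, ?_, rfl⟩
  · have hd : DifferentiableOn ℂ (fun w => (1 - w) ^ (-a') *
        ∑' p : ℕ × ℕ, appellPfaffCoeff a a' b b' c p * (x ^ p.1 * (w / (w - 1)) ^ p.2))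
        {w : ℂ | w.re < 1 / 2} := by
      refine DifferentiableOn.mul ?_ ?_
      · refine DifferentiableOn.cpow_const (by fun_prop) fun w hw => Or.inl ?_
        simp only [Set.mem_ofPred_eq] at hw
        simp
        linarith
      · refine (differentiableOn_tsum_appellPfaffCoeff a a' b b' hc hx).comp
          (g := fun v => ∑' p : ℕ × ℕ, appellPfaffCoeff a a' b b' c p * (x ^ p.1 * v ^ p.2))
          (f := fun w => w / (w - 1)) ?_ fun w hw => ?_
        · exact DifferentiableOn.div (by fun_prop) (by fun_prop) hne
        · exact mem_ball_zero_iff.2 (norm_div_sub_one_lt_one hw)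
    refine (hd.analyticOnNhd hopen).mono fun w hw => ?_
    obtain ⟨s, t, hs, ht, hst, rfl⟩ := hw
    rcases ht.eq_or_lt with rfl | ht
    · simp
    · simp
      nlinarith
  · filter_upwards [Metric.ball_mem_nhds (0 : ℂ) (by norm_num : (0 : ℝ) < 1 / 8)] with w hw
    rw [mem_ball_zero_iff] at hw
    have hre : w.re < 1 / 2 := by linarith [Complex.re_le_norm w]
    rw [appellF3Series_eq_tsum a a' b b' hc hx (hw.trans (by norm_num)),
      (summable_appellPfaffCoeff a a' b b' hc hx (norm_div_sub_one_lt_one hre)).tsum_prod,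
      ← tsum_mul_left]
    refine tsum_congr fun m => ?_
    rw [← pfaff a' b' (re_add_natCast_pos hc m) hw, ← tsum_mul_left, ← tsum_mul_left,
      ← tsum_mul_left]
    refine tsum_congr fun k => ?_
    rw [appellPfaffCoeff]
    ring

/-- On the ray which is relevant for the right-sided Saigo--Maeda operators, `F₃` is given by a
power series in one variable, up to a factor. -/
theorem appellF3_ray (a a' b b' : ℂ) {c : ℂ} (hc : 0 < c.re) {u : ℝ} (hu : 1 < u) :
    appellF3 a a' b b' c ((1 - 1 / u : ℝ) : ℂ) ((1 - u : ℝ) : ℂ) =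
      (u : ℂ) ^ (-a') * ∑' p : ℕ × ℕ, appellPfaffCoeff a a' b b' c p *
        ((1 - 1 / u : ℝ) : ℂ) ^ (p.1 + p.2) := by
  have h0 : 0 < u := by linarith
  have hx : ‖((1 - 1 / u : ℝ) : ℂ)‖ < 1 := by
    have h1 : 1 / u < 1 := by rw [div_lt_one h0]; exact hu
    have h2 : 0 < 1 / u := by positivity
    rw [Complex.norm_real, Real.norm_of_nonneg (by linarith)]
    linarith
  rw [(isAppellF3Value a a' b b' hc hx (by simp; linarith)).appellF3_eq]
  -- The transformed second variable coincides with the first one, so the two powers merge.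
  have e1 : ((1 - u : ℝ) : ℂ) / (((1 - u : ℝ) : ℂ) - 1) = ((1 - 1 / u : ℝ) : ℂ) := by
    have : (u : ℂ) ≠ 0 := by exact_mod_cast h0.ne'
    push_cast
    rw [show (1 - (u : ℂ) - 1) = -u by ring]
    field_simp
    ring
  rw [e1]
  congr 2
  · push_cast; ring
  · ext p; rw [pow_add]

/-! ### Gauss's summation theorem at 1. -/

/-- A real majorant of the coefficients of `₂F₁(a, b; c; ·)` for `Re c ≥ r`. -/
noncomputable def gaussMajorant (a b : ℂ) (r : ℝ) (n : ℕ) : ℝ :=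
  ∏ j ∈ Finset.range n, (‖a + j‖ * ‖b + j‖ / ((r + j) * (j + 1)))

theorem gaussMajorant_nonneg (a b : ℂ) {r : ℝ} (hr : 0 < r) (n : ℕ) : 0 ≤ gaussMajorant a b r n :=
  Finset.prod_nonneg fun _ _ => by positivity

theorem norm_natCast_add_one (n : ℕ) : ‖((n : ℂ) + 1)‖ = n + 1 := by
  exact_mod_cast Complex.norm_natCast (n + 1)

theorem norm_gaussCoeff_le_majorant (a b : ℂ) {c : ℂ} {r : ℝ} (hr : 0 < r) (hc : r ≤ c.re) (n : ℕ) :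
    ‖gaussCoeff a b c n‖ ≤ gaussMajorant a b r n := by
  induction n with
  | zero => simp [gaussCoeff_zero, gaussMajorant]
  | succ n ih =>
    rw [gaussCoeff_succ, gaussMajorant, Finset.prod_range_succ, ← gaussMajorant, norm_mul, norm_div,
      norm_mul, norm_mul, norm_natCast_add_one]
    have := add_re_le_norm_add hc n
    have := gaussMajorant_nonneg a b hr n
    gcongr

/-- Decay of order n^(-2): the weighted sequence is eventually decreasing. This gives both
summability and n * `gaussCoeff` → 0. The condition on r is stronger than Gauss's theorem requires,
but the result is used only for lower parameters of large real part. -/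
theorem exists_gaussMajorant_le (a b : ℂ) {r : ℝ} (hr : 0 < r) (h : ‖a‖ + ‖b‖ + 1 < r) :
    ∃ C : ℝ, ∀ n : ℕ, gaussMajorant a b r n * ((n + 1) * (n + 2)) ≤ C := by
  set w : ℕ → ℝ := fun n => gaussMajorant a b r n * ((n + 1) * (n + 2)) with hw
  have hw0 (n : ℕ) : 0 ≤ w n := mul_nonneg (gaussMajorant_nonneg a b hr n) (by positivity)
  -- In the difference of the two cubics compared in `key`, the coefficient of n² is r - (‖a‖ + ‖b‖
  -- + 1) > 0; beyond K this term outweighs the possibly negative lower ones.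
  obtain ⟨K, hK⟩ := exists_nat_ge
    ((‖a‖ * ‖b‖ + 3 * (‖a‖ + ‖b‖) + 3 * (‖a‖ * ‖b‖) + 1) / (r - (‖a‖ + ‖b‖ + 1)))
  have hδ : 0 < r - (‖a‖ + ‖b‖ + 1) := by linarith
  rw [div_le_iff₀ hδ] at hK
  have hstep (n : ℕ) (hn : K ≤ n) : w (n + 1) ≤ w n := by
    have hn' : (K : ℝ) ≤ n := by exact_mod_cast hn
    have ha : ‖a + n‖ ≤ ‖a‖ + n := by simpa using norm_add_le a (n : ℂ)
    have hb : ‖b + n‖ ≤ ‖b‖ + n := by simpa using norm_add_le b (n : ℂ)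
    have key : ‖a + n‖ * ‖b + n‖ * (n + 3) ≤ (r + n) * (n + 1) * (n + 1) := by
      have ha0 := norm_nonneg a
      have hb0 := norm_nonneg b
      have hn0 : (0 : ℝ) ≤ n := n.cast_nonneg
      have hp := mul_nonneg ha0 hb0
      have h1 : ‖a + n‖ * ‖b + n‖ ≤ (‖a‖ + n) * (‖b‖ + n) := by gcongr
      have h2 : ‖a‖ * ‖b‖ + 3 * (‖a‖ + ‖b‖) + 3 * (‖a‖ * ‖b‖) + 1 ≤
          n * (r - (‖a‖ + ‖b‖ + 1)) := hK.trans (by gcongr)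
      calc _ ≤ (‖a‖ + n) * (‖b‖ + n) * (n + 3) := by gcongr
        _ ≤ _ := by nlinarith [mul_le_mul_of_nonneg_left h2 hn0, mul_nonneg hn0 hδ.le]
    have hr' : 0 < (r + n) * (n + 1) := by positivity
    have h0 := gaussMajorant_nonneg a b hr n
    simp only [hw]
    rw [gaussMajorant, Finset.prod_range_succ, ← gaussMajorant, mul_assoc]
    refine mul_le_mul_of_nonneg_left ?_ h0
    rw [div_mul_eq_mul_div, div_le_iff₀ hr']
    push_cast
    have : (0 : ℝ) ≤ n + 2 := by positivity
    nlinarith [mul_le_mul_of_nonneg_right key this]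
  refine ⟨∑ n ∈ Finset.range (K + 1), w n, fun n => ?_⟩
  rcases le_total n K with hn | hn
  · exact Finset.single_le_sum (fun i _ => hw0 i) (Finset.mem_range.2 (by lia))
  · have : w n ≤ w K := by
      induction n, hn using Nat.le_induction with
      | base => rfl
      | succ n hn ih => exact (hstep n hn).trans ih
    exact this.trans (Finset.single_le_sum (f := w) (fun i _ => hw0 i) (Finset.mem_range.2 (by lia)))

theorem summable_gaussMajorant (a b : ℂ) {r : ℝ} (hr : 0 < r) (h : ‖a‖ + ‖b‖ + 1 < r) :
    Summable (gaussMajorant a b r) := by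
  obtain ⟨C, hC⟩ := exists_gaussMajorant_le a b hr h
  have hC0 : 0 ≤ C := (mul_nonneg (gaussMajorant_nonneg a b hr 0) (by positivity)).trans (hC 0)
  have hs : Summable fun n : ℕ => C * (1 / ((n + 1 : ℕ) : ℝ) ^ 2) :=
    ((summable_nat_add_iff 1).2 (Real.summable_one_div_nat_pow.2 one_lt_two)).mul_left C
  refine Summable.of_nonneg_of_le (gaussMajorant_nonneg a b hr) (fun n => ?_) hs
  have h1 : (0 : ℝ) < ((n + 1 : ℕ) : ℝ) ^ 2 := by positivity
  rw [mul_one_div, le_div_iff₀ h1]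
  refine le_trans (mul_le_mul_of_nonneg_left ?_ (gaussMajorant_nonneg a b hr n)) (hC n)
  push_cast
  nlinarith [(Nat.cast_nonneg n : (0 : ℝ) ≤ n)]

theorem tendsto_natCast_mul_gaussCoeff (a b : ℂ) {c : ℂ} (hc : ‖a‖ + ‖b‖ + 1 < c.re) :
    Tendsto (fun n : ℕ => (n : ℂ) * gaussCoeff a b c n) atTop (𝓝 0) := by
  have hr : 0 < c.re := lt_of_le_of_lt (by positivity) hc
  obtain ⟨C, hC⟩ := exists_gaussMajorant_le a b hr hc
  have hlim : Tendsto (fun n : ℕ => C / ((n : ℝ) + 2)) atTop (𝓝 0) :=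
    (tendsto_atTop_add_const_right _ _ tendsto_natCast_atTop_atTop).const_div_atTop C
  refine squeeze_zero_norm (fun n => ?_) hlim
  have h2 : (0 : ℝ) < n + 2 := by positivity
  rw [norm_mul, Complex.norm_natCast, le_div_iff₀ h2]
  have := norm_gaussCoeff_le_majorant a b hr le_rfl n
  calc _ ≤ (n : ℝ) * gaussMajorant a b c.re n * (n + 2) := by gcongr
    _ ≤ gaussMajorant a b c.re n * ((n + 1) * (n + 2)) := by
      nlinarith [mul_nonneg (gaussMajorant_nonneg a b hr n) h2.le]
    _ ≤ C := hC n

theorem summable_gaussCoeff (a b : ℂ) {c : ℂ} (hc : ‖a‖ + ‖b‖ + 1 < c.re) :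
    Summable (gaussCoeff a b c) :=
  have hr : 0 < c.re := lt_of_le_of_lt (by positivity) hc
  Summable.of_norm_bounded (summable_gaussMajorant a b hr hc)
    (norm_gaussCoeff_le_majorant a b hr le_rfl)

theorem gaussCoeff_add_one_right (a b : ℂ) {c : ℂ} (hc : 0 < c.re) (n : ℕ) :
    gaussCoeff a b (c + 1) n = gaussCoeff a b c n * (c / (c + n)) := by
  have h := pochhammerC_succ_left c n
  rw [pochhammerC_succ] at h
  have h0 : c ≠ 0 := by simpa using add_natCast_ne_zero hc 0
  have hn := add_natCast_ne_zero hc n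
  have hp := pochhammerC_ne_zero hc n
  have hf : (n.factorial : ℂ) ≠ 0 := by exact_mod_cast n.factorial_ne_zero
  have h1 : pochhammerC (c + 1) n = pochhammerC c n * (c + n) / c := by
    rw [h]; field_simp
  simp only [gaussCoeff, h1]
  field_simp

theorem tsum_gaussCoeff_contiguous (a b : ℂ) {c : ℂ} (hc : ‖a‖ + ‖b‖ + 1 < c.re) :
    (c - a - b) * c * ∑' n, gaussCoeff a b c n =
      (c - a) * (c - b) * ∑' n, gaussCoeff a b (c + 1) n := by
  have hr : 0 < c.re := lt_of_le_of_lt (by positivity) hc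
  have hs := summable_gaussCoeff a b hc
  have hs1 : Summable (gaussCoeff a b (c + 1)) := summable_gaussCoeff a b (by simp; linarith)
  -- A telescoping certificate: the difference of the two summands is R (n + 1) - R n, with R 0 = 0
  -- and R n → 0.
  set R : ℕ → ℂ := fun n => -c * (n * gaussCoeff a b c n) with hR
  have htel (n : ℕ) : (c - a - b) * c * gaussCoeff a b c n -
      (c - a) * (c - b) * gaussCoeff a b (c + 1) n = R (n + 1) - R n := by
    have hn := add_natCast_ne_zero hr n
    have hn1 : (n : ℂ) + 1 ≠ 0 := by exact_mod_cast n.succ_ne_zero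
    simp only [hR]
    rw [gaussCoeff_add_one_right a b hr, gaussCoeff_succ]
    push_cast
    field_simp
    ring
  have hsum := (hs.hasSum.mul_left ((c - a - b) * c)).sub (hs1.hasSum.mul_left ((c - a) * (c - b)))
  simp_rw [htel] at hsum
  have h1 := hsum.tendsto_sum_nat
  simp_rw [Finset.sum_range_sub] at h1
  have h2 : Tendsto (fun n => R n - R 0) atTop (𝓝 0) := by
    have := ((tendsto_natCast_mul_gaussCoeff a b hc).const_mul (-c)).sub_const (R 0)
    simpa [hR] using this
  exact sub_eq_zero.1 (tendsto_nhds_unique h1 h2)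

theorem tsum_gaussCoeff_shift (a b : ℂ) {c : ℂ} (hc : ‖a‖ + ‖b‖ + 1 < c.re) (n : ℕ) :
    pochhammerC (c - a - b) n * pochhammerC c n * ∑' k, gaussCoeff a b c k =
      pochhammerC (c - a) n * pochhammerC (c - b) n * ∑' k, gaussCoeff a b (c + n) k := by
  induction n with
  | zero => simp [pochhammerC_zero]
  | succ n ih =>
    have h := tsum_gaussCoeff_contiguous a b (hc.trans_le (re_le_re_add_natCast c n))
    simp only [pochhammerC_succ]
    push_cast
    rw [← add_assoc]
    linear_combination (c - a - b + n) * (c + n) * ih +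
      pochhammerC (c - a) n * pochhammerC (c - b) n * h

/-- Only the term k = 0 survives as the lower parameter grows; the majorant for c itself dominates
all the shifted series. -/
theorem tendsto_tsum_gaussCoeff (a b : ℂ) {c : ℂ} (hc : ‖a‖ + ‖b‖ + 1 < c.re) :
    Tendsto (fun n : ℕ => ∑' k, gaussCoeff a b (c + n) k) atTop (𝓝 1) := by
  have hr : 0 < c.re := lt_of_le_of_lt (by positivity) hc
  have h1 : (1 : ℂ) = ∑' k : ℕ, if k = 0 then 1 else 0 := by simp
  rw [h1]
  refine tendsto_tsum_of_dominated_convergence (summable_gaussMajorant a b hr hc) (fun k => ?_)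
    (Eventually.of_forall fun n k => norm_gaussCoeff_le_majorant a b hr (by simp) k)
  rcases k with _ | k
  · simp [gaussCoeff_zero]
  · simp only [Nat.add_eq_zero_iff, one_ne_zero, and_false, if_false]
    have hlim : Tendsto (fun n : ℕ => gaussMajorant a b (c.re + n) (k + 1)) atTop (𝓝 0) := by
      have h2 := tendsto_finsetProd (Finset.range (k + 1)) (f := fun (j n : ℕ) =>
        ‖a + j‖ * ‖b + j‖ / ((c.re + n + j) * (j + 1))) (a := fun _ => (0 : ℝ)) (x := atTop)
        fun j _ => Tendsto.const_div_atTop ((tendsto_atTop_add_const_right _ _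
          (tendsto_atTop_add_const_left _ _ tendsto_natCast_atTop_atTop)).atTop_mul_const
          (by positivity)) _
      simpa [gaussMajorant] using h2
    refine squeeze_zero_norm (fun n => ?_) hlim
    exact norm_gaussCoeff_le_majorant a b (by positivity) (by simp) _

theorem GammaSeq_eq_pochhammerC (s : ℂ) (n : ℕ) :
    Complex.GammaSeq s n = (n : ℂ) ^ s * (n.factorial : ℂ) / pochhammerC s (n + 1) := by
  have (m : ℕ) : ∏ j ∈ Finset.range m, (s + j) = pochhammerC s m := by
    induction m with
    | zero => simp [pochhammerC_zero]
    | succ m ih => rw [Finset.prod_range_succ, ih, pochhammerC_succ]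
  rw [Complex.GammaSeq, this]

/-- Gauss's theorem on the value of `₂F₁` at `1`. -/
theorem hasSum_gaussCoeff (a b : ℂ) {c : ℂ} (hc : ‖a‖ + ‖b‖ + 1 < c.re) :
    HasSum (gaussCoeff a b c) (Complex.Gamma c * Complex.Gamma (c - a - b) /
      (Complex.Gamma (c - a) * Complex.Gamma (c - b))) := by
  have ha := Complex.re_le_norm a
  have hb := Complex.re_le_norm b
  have ha0 := norm_nonneg a
  have hb0 := norm_nonneg b
  have hr : 0 < c.re := by linarith
  have hca : 0 < (c - a).re := by simp; linarith
  have hcb : 0 < (c - b).re := by simp; linarith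
  have hcab : 0 < (c - a - b).re := by simp; linarith
  -- Iterating the contiguous relation n + 1 times leaves a quotient of Pochhammer symbols. Euler's
  -- limit turns it into Gamma functions, the powers of n cancelling because c + (c - a - b) = (c -
  -- a) + (c - b). The shift is n + 1 because `Complex.GammaSeq s n` has n + 1 factors below.
  have hlim : Tendsto (fun n : ℕ => Complex.GammaSeq c n * Complex.GammaSeq (c - a - b) n /
      (Complex.GammaSeq (c - a) n * Complex.GammaSeq (c - b) n) *
      ∑' k, gaussCoeff a b (c + (n + 1 : ℕ)) k) atTop
      (𝓝 (Complex.Gamma c * Complex.Gamma (c - a - b) /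
      (Complex.Gamma (c - a) * Complex.Gamma (c - b)) * 1)) := by
    refine Tendsto.mul (Tendsto.div ?_ ?_ ?_) ?_
    · exact (Complex.GammaSeq_tendsto_Gamma _).mul (Complex.GammaSeq_tendsto_Gamma _)
    · exact (Complex.GammaSeq_tendsto_Gamma _).mul (Complex.GammaSeq_tendsto_Gamma _)
    · exact mul_ne_zero (Complex.Gamma_ne_zero_of_re_pos hca) (Complex.Gamma_ne_zero_of_re_pos hcb)
    · exact (tendsto_tsum_gaussCoeff a b hc).comp (tendsto_add_atTop_nat 1)
  have hconst : ∀ᶠ n : ℕ in atTop, Complex.GammaSeq c n * Complex.GammaSeq (c - a - b) n /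
      (Complex.GammaSeq (c - a) n * Complex.GammaSeq (c - b) n) *
      ∑' k, gaussCoeff a b (c + (n + 1 : ℕ)) k = ∑' k, gaussCoeff a b c k := by
    filter_upwards [eventually_ne_atTop 0] with n hn
    have hn' : (n : ℂ) ≠ 0 := by exact_mod_cast hn
    have h := tsum_gaussCoeff_shift a b hc (n + 1)
    have p1 := pochhammerC_ne_zero hr (n + 1)
    have p2 := pochhammerC_ne_zero hca (n + 1)
    have p3 := pochhammerC_ne_zero hcb (n + 1)
    have p4 := pochhammerC_ne_zero hcab (n + 1)
    have q2 : (n : ℂ) ^ (c - a) ≠ 0 := by simp [Complex.cpow_eq_zero_iff, hn']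
    have q3 : (n : ℂ) ^ (c - b) ≠ 0 := by simp [Complex.cpow_eq_zero_iff, hn']
    have hf : (n.factorial : ℂ) ≠ 0 := by exact_mod_cast n.factorial_ne_zero
    have hq : (n : ℂ) ^ c * (n : ℂ) ^ (c - a - b) = (n : ℂ) ^ (c - a) * (n : ℂ) ^ (c - b) := by
      rw [← Complex.cpow_add _ _ hn', ← Complex.cpow_add _ _ hn']
      congr 1
      ring
    have h' : ∑' k, gaussCoeff a b c k = pochhammerC (c - a) (n + 1) * pochhammerC (c - b) (n + 1) *
        (∑' k, gaussCoeff a b (c + (n + 1 : ℕ)) k) /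
        (pochhammerC (c - a - b) (n + 1) * pochhammerC c (n + 1)) := by
      rw [← h]; field_simp
    rw [h']
    simp only [GammaSeq_eq_pochhammerC]
    have e : (n : ℂ) ^ c * (n.factorial : ℂ) / pochhammerC c (n + 1) *
        ((n : ℂ) ^ (c - a - b) * (n.factorial : ℂ) / pochhammerC (c - a - b) (n + 1)) =
        ((n : ℂ) ^ (c - a) * (n : ℂ) ^ (c - b)) * (n.factorial : ℂ) ^ 2 /
        (pochhammerC c (n + 1) * pochhammerC (c - a - b) (n + 1)) := by
      rw [← hq]; field_simp
    rw [e]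
    field_simp
  have := tendsto_nhds_unique (hlim.congr' hconst) tendsto_const_nhds
  rw [mul_one] at this
  rw [this]
  exact (summable_gaussCoeff a b hc).hasSum

/-! ### Beta integrals over (1, ∞), by the substitution u = 1/x. -/

theorem ofReal_cpow_eq_exp {x : ℝ} (hx : 0 < x) (s : ℂ) :
    (x : ℂ) ^ s = Complex.exp ((Real.log x : ℝ) * s) := by
  rw [Complex.cpow_def_of_ne_zero (by exact_mod_cast hx.ne'), Complex.ofReal_log hx.le]

theorem image_inv_Ioo_zero_one : (fun x : ℝ => x⁻¹) '' Set.Ioo 0 1 = Set.Ioi 1 := by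
  ext u
  constructor
  · rintro ⟨x, hx, rfl⟩
    exact (one_lt_inv₀ hx.1).2 hx.2
  · intro hu
    have h0 : (0 : ℝ) < u := one_pos.trans hu
    exact ⟨u⁻¹, ⟨inv_pos.2 h0, inv_lt_one_of_one_lt₀ hu⟩, inv_inv u⟩

theorem abs_deriv_inv_smul_betaIntegrand (P S : ℂ) {x : ℝ} (hx : x ∈ Set.Ioo (0 : ℝ) 1) :
    |-(x ^ 2)⁻¹| • (((x⁻¹ - 1 : ℝ) : ℂ) ^ (S - 1) * ((x⁻¹ : ℝ) : ℂ) ^ (-P - S)) =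
      (x : ℂ) ^ (P - 1) * (1 - x : ℂ) ^ (S - 1) := by
  have hx0 := hx.1
  have hx1 : 0 < 1 - x := by linarith [hx.2]
  have e1 : x⁻¹ - 1 = (1 - x) / x := by field_simp
  have e2 : |-(x ^ 2)⁻¹| = Real.exp (-2 * Real.log x) := by
    rw [abs_neg, abs_of_pos (by positivity), mul_comm, Real.exp_mul, Real.exp_log hx0,
      Real.rpow_neg hx0.le]
    norm_num
  have e3 : (1 - x : ℂ) = ((1 - x : ℝ) : ℂ) := by push_cast; ring
  rw [e1, e2, e3, Complex.real_smul, Complex.ofReal_exp, ofReal_cpow_eq_exp (div_pos hx1 hx0),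
    ofReal_cpow_eq_exp (inv_pos.2 hx0), ofReal_cpow_eq_exp hx0, ofReal_cpow_eq_exp hx1,
    Real.log_div hx1.ne' hx0.ne', Real.log_inv, ← Complex.exp_add, ← Complex.exp_add,
    ← Complex.exp_add]
  congr 1
  push_cast
  ring

theorem hasDerivWithinAt_inv_Ioo (x : ℝ) (hx : x ∈ Set.Ioo (0 : ℝ) 1) :
    HasDerivWithinAt (fun x : ℝ => x⁻¹) (-(x ^ 2)⁻¹) (Set.Ioo 0 1) x :=
  (hasDerivAt_inv hx.1.ne').hasDerivWithinAt

theorem integrableOn_betaIntegrand_Ioi {P S : ℂ} (hP : 0 < P.re) (hS : 0 < S.re) :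
    IntegrableOn (fun u : ℝ => ((u - 1 : ℝ) : ℂ) ^ (S - 1) * (u : ℂ) ^ (-P - S)) (Set.Ioi 1) := by
  rw [← image_inv_Ioo_zero_one, integrableOn_image_iff_integrableOn_abs_deriv_smul
    measurableSet_Ioo hasDerivWithinAt_inv_Ioo inv_injective.injOn]
  have h := Complex.betaIntegral_convergent hP hS
  rw [intervalIntegrable_iff_integrableOn_Ioo_of_le zero_le_one] at h
  exact h.congr_fun (fun x hx => (abs_deriv_inv_smul_betaIntegrand P S hx).symm) measurableSet_Ioo

theorem integral_betaIntegrand_Ioi (P S : ℂ) :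
    ∫ u in Set.Ioi (1 : ℝ), ((u - 1 : ℝ) : ℂ) ^ (S - 1) * (u : ℂ) ^ (-P - S) =
      Complex.betaIntegral P S := by
  rw [← image_inv_Ioo_zero_one, integral_image_eq_integral_abs_deriv_smul
    measurableSet_Ioo hasDerivWithinAt_inv_Ioo inv_injective.injOn, Complex.betaIntegral,
    intervalIntegral.integral_of_le zero_le_one, integral_Ioc_eq_integral_Ioo]
  exact setIntegral_congr_fun measurableSet_Ioo fun x hx => abs_deriv_inv_smul_betaIntegrand P S hx

theorem integrableOn_rpow_mul_rpow_Ioi {p s : ℝ} (hp : 0 < p) (hs : 0 < s) :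
    IntegrableOn (fun u : ℝ => (u - 1) ^ (s - 1) * u ^ (-p - s)) (Set.Ioi 1) := by
  have h := (integrableOn_betaIntegrand_Ioi (P := (p : ℂ)) (S := (s : ℂ)) (by simpa) (by simpa)).norm
  refine IntegrableOn.congr_fun h (fun u hu => ?_) measurableSet_Ioi
  have hu1 : (1 : ℝ) < u := hu
  simp only [norm_mul]
  rw [Complex.norm_cpow_eq_rpow_re_of_pos (by linarith),
    Complex.norm_cpow_eq_rpow_re_of_pos (by linarith)]
  simp

/-! ### Mellin transform of the kernel for exponents of strong decay. -/

/-- The kernel of the right-sided Saigo--Maeda integral at `x = 1`. -/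
noncomputable def saigoKernel (a a' b b' c : ℂ) (u : ℝ) : ℂ :=
  ((u - 1 : ℝ) : ℂ) ^ (c - 1) * (u : ℂ) ^ (-a) *
    appellF3 a a' b b' c ((1 - 1 / u : ℝ) : ℂ) ((1 - u : ℝ) : ℂ)

theorem one_sub_one_div_mem {u : ℝ} (hu : 1 < u) : 1 - 1 / u ∈ Set.Ioo (0 : ℝ) 1 := by
  have h0 : 0 < u := by linarith
  have h1 : 1 / u < 1 := by rw [div_lt_one h0]; exact hu
  have h2 : 0 < 1 / u := by positivity
  constructor <;> linarith

theorem saigoKernel_eq (a a' b b' : ℂ) {c : ℂ} (hc : 0 < c.re) {u : ℝ} (hu : 1 < u) :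
    saigoKernel a a' b b' c u = ((u - 1 : ℝ) : ℂ) ^ (c - 1) * (u : ℂ) ^ (-a - a') *
      ∑' p : ℕ × ℕ, appellPfaffCoeff a a' b b' c p * ((1 - 1 / u : ℝ) : ℂ) ^ (p.1 + p.2) := by
  have hu0 : (u : ℂ) ≠ 0 := by exact_mod_cast (by linarith : u ≠ 0)
  rw [saigoKernel, appellF3_ray a a' b b' hc hu, sub_eq_add_neg (-a), Complex.cpow_add _ _ hu0]
  ring

/-- Since 1 - (1 - 1/u) = 1/u, each negative binomial series sums to a power of u. Thus the majorant
of the series in the kernel grows only polynomially. -/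
theorem hasSum_choose_mul_choose_mul_pow (e₁ e₂ : ℕ) {u : ℝ} (hu : 1 < u) :
    HasSum (fun p : ℕ × ℕ => (((p.1 + e₁).choose e₁ : ℝ) * ((p.2 + e₂).choose e₂ : ℝ)) *
      (1 - 1 / u) ^ (p.1 + p.2)) (u ^ (e₁ + 1 + (e₂ + 1))) := by
  obtain ⟨h0, h1⟩ := one_sub_one_div_mem hu
  have hn : ‖(1 - 1 / u : ℝ)‖ < 1 := by rwa [Real.norm_of_nonneg h0.le]
  have hs := summable_choose_mul_pow_prod e₁ e₂ h0.le h1 h0.le h1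
  have H := (hasSum_choose_mul_geometric_of_norm_lt_one e₁ hn).mul
    (hasSum_choose_mul_geometric_of_norm_lt_one e₂ hn) hs
  have hu0 : u ≠ 0 := by linarith
  have e : u ^ (e₁ + 1 + (e₂ + 1)) =
      1 / (1 - (1 - 1 / u)) ^ (e₁ + 1) * (1 / (1 - (1 - 1 / u)) ^ (e₂ + 1)) := by
    rw [sub_sub_cancel, pow_add, one_div_pow, one_div_pow, one_div_one_div, one_div_one_div]
  rw [e]
  refine H.congr_fun fun p => ?_
  rw [pow_add]
  ring

theorem integrable_of_hasSum_of_dominated {X ι : Type*} [MeasurableSpace X] {m : Measure X}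
    [Countable ι] {F : ι → X → ℂ} {f : X → ℂ} (bound : ι → X → ℝ)
    (hF : ∀ i, AEStronglyMeasurable (F i) m) (hb : ∀ i, ∀ᵐ x ∂m, ‖F i x‖ ≤ bound i x)
    (hs : ∀ᵐ x ∂m, Summable fun i => bound i x) (hi : Integrable (fun x => ∑' i, bound i x) m)
    (hlim : ∀ᵐ x ∂m, HasSum (fun i => F i x) (f x)) : Integrable f m := by
  refine Integrable.mono' hi ?_ ?_
  · exact aestronglyMeasurable_of_tendsto_ae atTop
      (f := fun (s : Finset ι) x => ∑ i ∈ s, F i x)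
      (fun s => Finset.aestronglyMeasurable_fun_sum s fun i _ => hF i) hlim
  · filter_upwards [ae_all_iff.2 hb, hs, hlim] with x h1 h2 h3
    rw [← h3.tsum_eq]
    exact tsum_of_norm_bounded h2.hasSum h1

/-- The exponent a + a' - c - P is chosen so that the powers outside the series become (u - 1)^(c -
1) u^(-P - c). A factor (1 - 1/u)^N then replaces c by c + N, again a Beta integrand. E is the
degree of growth of the majorant. -/
theorem hasSum_saigoKernel_mellin (a a' b b' : ℂ) {c : ℂ} (hc : 0 < c.re) :
    ∃ E : ℝ, 0 ≤ E ∧ ∀ P : ℂ, E < P.re → IntegrableOn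
      (fun u : ℝ => saigoKernel a a' b b' c u * (u : ℂ) ^ (a + a' - c - P)) (Set.Ioi 1) ∧ HasSum
      (fun p : ℕ × ℕ => appellPfaffCoeff a a' b b' c p *
        Complex.betaIntegral P (c + (p.1 + p.2 : ℕ)))
      (∫ u in Set.Ioi (1 : ℝ), saigoKernel a a' b b' c u * (u : ℂ) ^ (a + a' - c - P)) := by
  obtain ⟨e₁, e₂, he⟩ := exists_appellPfaffCoeff_bound a a' b b' hc
  refine ⟨((e₁ + 1 + (e₂ + 1) : ℕ) : ℝ), by positivity, fun P hP => ?_⟩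
  set E : ℕ := e₁ + 1 + (e₂ + 1)
  set F : ℕ × ℕ → ℝ → ℂ := fun p u => appellPfaffCoeff a a' b b' c p *
    ((1 - 1 / u : ℝ) : ℂ) ^ (p.1 + p.2) * (((u - 1 : ℝ) : ℂ) ^ (c - 1) * (u : ℂ) ^ (-P - c))
    with hF
  have hw0 {u : ℝ} (hu : 1 < u) : 0 ≤ (u - 1) ^ (c.re - 1) * u ^ (-P.re - c.re) :=
    mul_nonneg (Real.rpow_nonneg (by linarith) _) (Real.rpow_nonneg (by linarith) _)
  set bound : ℕ × ℕ → ℝ → ℝ := fun p u =>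
    (((p.1 + e₁).choose e₁ : ℝ) * ((p.2 + e₂).choose e₂ : ℝ)) * (1 - 1 / u) ^ (p.1 + p.2) *
      ((u - 1) ^ (c.re - 1) * u ^ (-P.re - c.re)) with hbound
  have hF1 (p : ℕ × ℕ) : AEStronglyMeasurable (F p) (volume.restrict (Set.Ioi 1)) := by
    exact Measurable.aestronglyMeasurable (by fun_prop)
  have hF2 (p : ℕ × ℕ) : ∀ᵐ u ∂volume.restrict (Set.Ioi 1), ‖F p u‖ ≤ bound p u := by
    filter_upwards [ae_restrict_mem measurableSet_Ioi] with u hu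
    have hu1 : (1 : ℝ) < u := hu
    have hx := (one_sub_one_div_mem hu1).1
    simp only [hF, hbound, norm_mul, norm_pow]
    rw [Complex.norm_cpow_eq_rpow_re_of_pos (by linarith),
      Complex.norm_cpow_eq_rpow_re_of_pos (by linarith), Complex.norm_real,
      Real.norm_of_nonneg hx.le]
    simp only [Complex.sub_re, Complex.neg_re, Complex.one_re]
    refine mul_le_mul_of_nonneg_right ?_ (hw0 hu1)
    exact mul_le_mul_of_nonneg_right (he p) (pow_nonneg hx.le _)
  have hF3 : ∀ᵐ u ∂volume.restrict (Set.Ioi 1), Summable fun p => bound p u := by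
    filter_upwards [ae_restrict_mem measurableSet_Ioi] with u hu
    exact ((hasSum_choose_mul_choose_mul_pow e₁ e₂ hu).summable).mul_right _
  have hF4 : IntegrableOn (fun u => ∑' p, bound p u) (Set.Ioi 1) := by
    have hint := integrableOn_rpow_mul_rpow_Ioi (p := P.re - E) (sub_pos.2 hP) hc
    refine IntegrableOn.congr_fun hint (fun u hu => ?_) measurableSet_Ioi
    have hu1 : (1 : ℝ) < u := hu
    have hu0 : 0 < u := by linarith
    simp only [hbound]
    rw [tsum_mul_right, (hasSum_choose_mul_choose_mul_pow e₁ e₂ hu).tsum_eq, mul_left_comm,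
      ← Real.rpow_natCast, ← Real.rpow_add hu0]
    congr 2
    ring
  have hF5 : ∀ᵐ u ∂volume.restrict (Set.Ioi 1), HasSum (fun p => F p u)
      (saigoKernel a a' b b' c u * (u : ℂ) ^ (a + a' - c - P)) := by
    filter_upwards [ae_restrict_mem measurableSet_Ioi] with u hu
    have hu1 : (1 : ℝ) < u := hu
    have hu0 : (u : ℂ) ≠ 0 := by exact_mod_cast (by linarith : u ≠ 0)
    have hx := one_sub_one_div_mem hu1
    have hs : Summable fun p : ℕ × ℕ => appellPfaffCoeff a a' b b' c p *
        ((1 - 1 / u : ℝ) : ℂ) ^ (p.1 + p.2) := by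
      have hn : ‖((1 - 1 / u : ℝ) : ℂ)‖ < 1 := by
        rw [Complex.norm_real, Real.norm_of_nonneg hx.1.le]; exact hx.2
      simpa only [← pow_add] using summable_appellPfaffCoeff a a' b b' hc hn hn
    have e : saigoKernel a a' b b' c u * (u : ℂ) ^ (a + a' - c - P) =
        (∑' p : ℕ × ℕ, appellPfaffCoeff a a' b b' c p *
          ((1 - 1 / u : ℝ) : ℂ) ^ (p.1 + p.2)) *
        (((u - 1 : ℝ) : ℂ) ^ (c - 1) * (u : ℂ) ^ (-P - c)) := by
      rw [saigoKernel_eq a a' b b' hc hu1, show -P - c = (-a - a') + (a + a' - c - P) by ring,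
        Complex.cpow_add (-a - a') _ hu0]
      ring
    rw [e]
    exact hs.hasSum.mul_right _
  refine ⟨integrable_of_hasSum_of_dominated bound hF1 hF2 hF3 hF4 hF5, ?_⟩
  have H := hasSum_integral_of_dominated_convergence bound hF1 hF2 hF3 hF4 hF5
  refine H.congr_fun fun p => ?_
  rw [← integral_betaIntegrand_Ioi, ← integral_const_mul]
  refine setIntegral_congr_fun measurableSet_Ioi fun u hu => ?_
  have hu1 : (1 : ℝ) < u := hu
  have hu0 : (u : ℂ) ≠ 0 := by exact_mod_cast (by linarith : u ≠ 0)
  have hu1' : ((u - 1 : ℝ) : ℂ) ≠ 0 := by exact_mod_cast (by linarith : u - 1 ≠ 0)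
  simp only [hF]
  set N := p.1 + p.2
  have e1 : ((1 - 1 / u : ℝ) : ℂ) = ((u - 1 : ℝ) : ℂ) / u := by
    push_cast; field_simp
  rw [e1, show c + N - 1 = (c - 1) + N by ring, show -P - (c + N) = (-P - c) - N by ring,
    Complex.cpow_add _ _ hu1', Complex.cpow_sub _ _ hu0, Complex.cpow_natCast,
    Complex.cpow_natCast, div_pow]
  ring

theorem gaussCoeff_mul_div (a b : ℂ) {c : ℂ} (hc : 0 < c.re) (d : ℂ) (n : ℕ) :
    gaussCoeff a b c n * (pochhammerC c n / pochhammerC d n) = gaussCoeff a b d n := by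
  have h := pochhammerC_ne_zero hc n
  simp only [gaussCoeff]
  field_simp

/-- The Mellin transform of the kernel, where the integral converges well. -/
theorem integral_saigoKernel (a a' b b' : ℂ) {c : ℂ} (hc : 0 < c.re) :
    ∃ R : ℝ, ∀ P Q : ℂ, Q = P + c → R < P.re →
      (∫ u in Set.Ioi (1 : ℝ), saigoKernel a a' b b' c u * (u : ℂ) ^ (a + a' - c - P)) *
        ((Complex.Gamma P)⁻¹ * (Complex.Gamma (Q - a' - c + b'))⁻¹ *
          (Complex.Gamma (Q - a' - a - b))⁻¹) =
      Complex.Gamma c * ((Complex.Gamma (Q - c + b'))⁻¹ * (Complex.Gamma (Q - a' - a))⁻¹ *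
          (Complex.Gamma (Q - a' - b))⁻¹) := by
  obtain ⟨E, hE0, hE⟩ := hasSum_saigoKernel_mellin a a' b b' hc
  -- Large enough for termwise integration, for both uses of Gauss's theorem, and for all Gamma
  -- arguments that are cancelled to have positive real part.
  refine ⟨E + ‖a‖ + ‖a'‖ + ‖b‖ + ‖b'‖ + ‖c‖ + 1, fun P Q hQ hP => ?_⟩
  have na := norm_nonneg a
  have na' := norm_nonneg a'
  have nb := norm_nonneg b
  have nb' := norm_nonneg b'
  have nc := norm_nonneg c
  have ra := Complex.abs_re_le_norm a
  have ra' := Complex.abs_re_le_norm a'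
  have rb := Complex.abs_re_le_norm b
  have rb' := Complex.abs_re_le_norm b'
  have rc := Complex.abs_re_le_norm c
  rw [abs_le] at ra ra' rb rb' rc
  have hQre : Q.re = P.re + c.re := by rw [hQ, Complex.add_re]
  have hP0 : 0 < P.re := by linarith
  have hQ0 : 0 < Q.re := by linarith
  have hQa : 0 < (Q - a').re := by simp; linarith
  have H := (hE P (by linarith)).2
  set I := ∫ u in Set.Ioi (1 : ℝ), saigoKernel a a' b b' c u * (u : ℂ) ^ (a + a' - c - P)
  have hterm (m k : ℕ) : appellPfaffCoeff a a' b b' c (m, k) *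
      Complex.betaIntegral P (c + (m + k : ℕ)) =
      Complex.Gamma P * Complex.Gamma c / Complex.Gamma Q * gaussCoeff a b Q m *
        gaussCoeff a' (c + m - b') (Q + m) k := by
    have hb := Complex.Gamma_mul_Gamma_eq_betaIntegral hP0 (re_add_natCast_pos hc (m + k))
    have hg : P + (c + (m + k : ℕ)) = Q + (m + k : ℕ) := by rw [hQ]; ring
    rw [hg, Gamma_add_natCast (ne_neg_natCast_of_re_pos hc),
      Gamma_add_natCast (ne_neg_natCast_of_re_pos hQ0), pochhammerC_add, pochhammerC_add] at hb
    have h1 := pochhammerC_ne_zero hQ0 m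
    have h2 := pochhammerC_ne_zero (re_add_natCast_pos hQ0 m) k
    have h3 := Complex.Gamma_ne_zero_of_re_pos hQ0
    have hb' : Complex.betaIntegral P (c + (m + k : ℕ)) =
        Complex.Gamma P * Complex.Gamma c / Complex.Gamma Q *
        (pochhammerC c m / pochhammerC Q m) *
        (pochhammerC (c + m) k / pochhammerC (Q + m) k) := by
      field_simp
      linear_combination -hb
    rw [hb', appellPfaffCoeff, ← gaussCoeff_mul_div a b hc Q,
      ← gaussCoeff_mul_div a' (c + m - b') (re_add_natCast_pos hc m) (Q + m)]
    ring
  -- First use of Gauss's theorem, in k. Its value depends on m only through Γ(Q + m) / Γ(Q - a' +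
  -- m), which changes the lower parameter of the outer series from Q to Q - a' and prepares the
  -- second use.
  have hfib (m : ℕ) := (hasSum_gaussCoeff a' (c + m - b') (c := Q + m) (by
    have h1 : ‖c + m - b'‖ ≤ ‖c‖ + m + ‖b'‖ := by
      refine (norm_sub_le _ _).trans ?_
      gcongr
      simpa using norm_add_le c (m : ℂ)
    simp only [Complex.add_re, Complex.natCast_re]
    linarith)).mul_left
      (Complex.Gamma P * Complex.Gamma c / Complex.Gamma Q * gaussCoeff a b Q m)
  have H1 := H.prod_fiberwise fun m => by simpa only [hterm] using hfib m
  have hval (m : ℕ) : Complex.Gamma P * Complex.Gamma c / Complex.Gamma Q * gaussCoeff a b Q m *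
      (Complex.Gamma (Q + m) * Complex.Gamma (Q + m - a' - (c + m - b')) /
        (Complex.Gamma (Q + m - a') * Complex.Gamma (Q + m - (c + m - b')))) =
      Complex.Gamma P * Complex.Gamma c * Complex.Gamma (Q - a' - c + b') /
        (Complex.Gamma (Q - a') * Complex.Gamma (Q - c + b')) * gaussCoeff a b (Q - a') m := by
    rw [show Q + m - a' - (c + m - b') = Q - a' - c + b' by ring,
      show Q + m - a' = (Q - a') + m by ring, show Q + m - (c + m - b') = Q - c + b' by ring,
      Gamma_add_natCast (ne_neg_natCast_of_re_pos hQ0),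
      Gamma_add_natCast (ne_neg_natCast_of_re_pos hQa), ← gaussCoeff_mul_div a b hQ0 (Q - a')]
    have h3 := Complex.Gamma_ne_zero_of_re_pos hQ0
    field_simp
  simp_rw [hval] at H1
  have H2 := (hasSum_gaussCoeff a b (c := Q - a') (by simp; linarith)).mul_left
    (Complex.Gamma P * Complex.Gamma c * Complex.Gamma (Q - a' - c + b') /
        (Complex.Gamma (Q - a') * Complex.Gamma (Q - c + b')))
  rw [H1.unique H2]
  have g1 := Complex.Gamma_ne_zero_of_re_pos hP0
  have g2 := Complex.Gamma_ne_zero_of_re_pos hQa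
  have g3 : Complex.Gamma (Q - a' - c + b') ≠ 0 :=
    Complex.Gamma_ne_zero_of_re_pos (by simp; linarith)
  have g4 : Complex.Gamma (Q - a' - a - b) ≠ 0 :=
    Complex.Gamma_ne_zero_of_re_pos (by simp; linarith)
  field_simp

/-! ### Extension to all exponents of absolute convergence. -/

theorem norm_ofReal_cpow_le_one {u : ℝ} (hu : 1 < u) {w : ℂ} (hw : w.re ≤ 0) :
    ‖(u : ℂ) ^ w‖ ≤ 1 := by
  rw [Complex.norm_cpow_eq_rpow_re_of_pos (by linarith)]
  exact Real.rpow_le_one_of_one_le_of_nonpos hu.le hw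

theorem measurable_ofReal_cpow (w : ℂ) : Measurable fun u : ℝ => (u : ℂ) ^ w := by fun_prop

theorem integrableOn_mul_cpow {ψ : ℝ → ℂ} (hψ : IntegrableOn ψ (Set.Ioi 1)) {w : ℂ}
    (hw : w.re ≤ 0) : IntegrableOn (fun u => ψ u * (u : ℂ) ^ w) (Set.Ioi 1) := by
  refine Integrable.mul_bdd (c := 1) hψ (measurable_ofReal_cpow w).aestronglyMeasurable ?_
  filter_upwards [ae_restrict_mem measurableSet_Ioi] with u hu
  exact norm_ofReal_cpow_le_one hu hw

theorem differentiableOn_integral_mul_cpow {ψ : ℝ → ℂ} (hψ : IntegrableOn ψ (Set.Ioi 1)) :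
    DifferentiableOn ℂ (fun w : ℂ => ∫ u in Set.Ioi (1 : ℝ), ψ u * (u : ℂ) ^ w)
      {w | w.re < 0} := by
  intro w₀ hw₀
  have hw₀' : w₀.re < 0 := hw₀
  set δ : ℝ := -w₀.re / 2 with hδ
  have hδ0 : 0 < δ := by rw [hδ]; linarith
  have hopen : IsOpen {w : ℂ | w.re < -δ} := isOpen_lt Complex.continuous_re continuous_const
  refine (hasDerivAt_integral_of_dominated_loc_of_deriv_le
    (F := fun w u => ψ u * (u : ℂ) ^ w) (F' := fun w u => ψ u * ((u : ℂ) ^ w * Real.log u))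
    (bound := fun u => ‖ψ u‖ * (1 / δ)) (hopen.mem_nhds (by simp [hδ]; linarith))
    (Eventually.of_forall fun w =>
      hψ.aestronglyMeasurable.mul (measurable_ofReal_cpow w).aestronglyMeasurable)
    (integrableOn_mul_cpow hψ hw₀'.le) ?_ ?_ (hψ.norm.mul_const _)
    ?_).2.differentiableAt.differentiableWithinAt
  · exact hψ.aestronglyMeasurable.mul (Measurable.aestronglyMeasurable (by fun_prop))
  · filter_upwards [ae_restrict_mem measurableSet_Ioi] with u hu w hw
    have hu1 : (1 : ℝ) < u := hu
    have hu0 : 0 < u := by linarith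
    have hw' : w.re < -δ := hw
    rw [norm_mul, norm_mul, Complex.norm_cpow_eq_rpow_re_of_pos hu0, Complex.norm_real,
      Real.norm_of_nonneg (Real.log_nonneg hu1.le)]
    refine mul_le_mul_of_nonneg_left ?_ (norm_nonneg _)
    -- The logarithm coming from differentiation in w is absorbed by the margin δ, through log u ≤
    -- u^δ / δ.
    calc u ^ w.re * Real.log u ≤ u ^ (-δ) * (u ^ δ / δ) := by
          gcongr
          · exact Real.log_nonneg hu1.le
          · exact hu1.le
          · exact Real.log_le_rpow_div hu0.le hδ0
      _ = 1 / δ := by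
        rw [← mul_div_assoc, ← Real.rpow_add hu0]
        simp
  · filter_upwards [ae_restrict_mem measurableSet_Ioi] with u hu w _
    have hu1 : (1 : ℝ) < u := hu
    have hu0 : (u : ℂ) ≠ 0 := by exact_mod_cast (by linarith : u ≠ 0)
    have h := (hasDerivAt_id w).const_cpow (c := (u : ℂ)) (Or.inl hu0)
    rw [← Complex.ofReal_log (by linarith)] at h
    simpa using h.const_mul (ψ u)

theorem tendsto_integral_mul_cpow {ψ : ℝ → ℂ} (hψ : IntegrableOn ψ (Set.Ioi 1)) {w : ℕ → ℂ}
    (hw : ∀ n, (w n).re ≤ 0) (hlim : Tendsto w atTop (𝓝 0)) :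
    Tendsto (fun n => ∫ u in Set.Ioi (1 : ℝ), ψ u * (u : ℂ) ^ w n) atTop
      (𝓝 (∫ u in Set.Ioi (1 : ℝ), ψ u)) := by
  refine tendsto_integral_of_dominated_convergence (fun u => ‖ψ u‖)
    (fun n => (integrableOn_mul_cpow hψ (hw n)).aestronglyMeasurable) hψ.norm (fun n => ?_) ?_
  · filter_upwards [ae_restrict_mem measurableSet_Ioi] with u hu
    rw [norm_mul]
    exact mul_le_of_le_one_right (norm_nonneg _) (norm_ofReal_cpow_le_one hu (hw n))
  · filter_upwards [ae_restrict_mem measurableSet_Ioi] with u hu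
    have hu1 : (1 : ℝ) < u := hu
    have hu0 : (u : ℂ) ≠ 0 := by exact_mod_cast (by linarith : u ≠ 0)
    have h := ((continuousAt_const_cpow hu0 (b := 0)).tendsto.comp hlim).const_mul (ψ u)
    simpa using h

theorem differentiable_Gamma_inv_comp {f : ℂ → ℂ} (hf : Differentiable ℂ f) :
    Differentiable ℂ fun w => (Complex.Gamma (f w))⁻¹ :=
  Complex.differentiable_one_div_Gamma.comp hf

/-- The Mellin transform of the kernel, wherever the integral converges absolutely. -/
theorem integral_saigoKernel_of_integrableOn (a a' b b' : ℂ) {c : ℂ} (hc : 0 < c.re) {P Q : ℂ}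
    (hQ : Q = P + c)
    (hint : IntegrableOn (fun u : ℝ => saigoKernel a a' b b' c u * (u : ℂ) ^ (a + a' - c - P))
      (Set.Ioi 1)) :
    (∫ u in Set.Ioi (1 : ℝ), saigoKernel a a' b b' c u * (u : ℂ) ^ (a + a' - c - P)) *
        ((Complex.Gamma P)⁻¹ * (Complex.Gamma (Q - a' - c + b'))⁻¹ *
          (Complex.Gamma (Q - a' - a - b))⁻¹) =
      Complex.Gamma c * ((Complex.Gamma (Q - c + b'))⁻¹ * (Complex.Gamma (Q - a' - a))⁻¹ *
          (Complex.Gamma (Q - a' - b))⁻¹) := by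
  obtain ⟨R, hR⟩ := integral_saigoKernel a a' b b' hc
  set ψ : ℝ → ℂ := fun u => saigoKernel a a' b b' c u * (u : ℂ) ^ (a + a' - c - P) with hψ
  -- The factor u^w moves P to P - w. Both sides, written with reciprocal Gamma functions, are
  -- holomorphic for Re w < 0, and they agree far to the left. The value w = 0 lies on the boundary,
  -- where N need not be holomorphic, so it is reached as a limit along negative reals by dominated
  -- convergence.
  set N : ℂ → ℂ := fun w => ∫ u in Set.Ioi (1 : ℝ), ψ u * (u : ℂ) ^ w with hN
  set V : ℂ → ℂ := fun w => (Complex.Gamma (P - w))⁻¹ * (Complex.Gamma (Q - w - a' - c + b'))⁻¹ *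
    (Complex.Gamma (Q - w - a' - a - b))⁻¹ with hV
  set W : ℂ → ℂ := fun w => Complex.Gamma c * ((Complex.Gamma (Q - w - c + b'))⁻¹ *
    (Complex.Gamma (Q - w - a' - a))⁻¹ * (Complex.Gamma (Q - w - a' - b))⁻¹) with hW
  have hopen : IsOpen {w : ℂ | w.re < 0} := isOpen_lt Complex.continuous_re continuous_const
  have hVd : Differentiable ℂ V :=
    ((differentiable_Gamma_inv_comp (by fun_prop)).mul
      (differentiable_Gamma_inv_comp (by fun_prop))).mul
      (differentiable_Gamma_inv_comp (by fun_prop))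
  have hWd : Differentiable ℂ W :=
    (((differentiable_Gamma_inv_comp (by fun_prop)).mul
      (differentiable_Gamma_inv_comp (by fun_prop))).mul
      (differentiable_Gamma_inv_comp (by fun_prop))).const_mul _
  have hL : AnalyticOnNhd ℂ (fun w => N w * V w) {w : ℂ | w.re < 0} :=
    ((differentiableOn_integral_mul_cpow hint).mul hVd.differentiableOn).analyticOnNhd hopen
  have hWa : AnalyticOnNhd ℂ W {w : ℂ | w.re < 0} := hWd.differentiableOn.analyticOnNhd hopen
  have hfar (w : ℂ) (hw : w.re < P.re - R) : N w * V w = W w := by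
    have h := hR (P - w) (Q - w) (by rw [hQ]; ring) (by simp; linarith)
    have hNw : N w = ∫ u in Set.Ioi (1 : ℝ),
        saigoKernel a a' b b' c u * (u : ℂ) ^ (a + a' - c - (P - w)) := by
      refine setIntegral_congr_fun measurableSet_Ioi fun u hu => ?_
      have hu1 : (1 : ℝ) < u := hu
      have hu0 : (u : ℂ) ≠ 0 := by exact_mod_cast (by linarith : u ≠ 0)
      simp only [hψ]
      rw [show a + a' - c - (P - w) = (a + a' - c - P) + w by ring, Complex.cpow_add _ _ hu0]
      ring
    rw [hNw]
    exact h
  set w₀ : ℂ := ((min 0 (P.re - R) - 1 : ℝ) : ℂ) with hw₀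
  have hw₀re : w₀.re = min 0 (P.re - R) - 1 := Complex.ofReal_re _
  have hEq : Set.EqOn (fun w => N w * V w) W {w : ℂ | w.re < 0} := by
    refine hL.eqOn_of_preconnected_of_eventuallyEq hWa
      (convex_halfSpace_re_lt 0).isPreconnected (z₀ := w₀) ?_ ?_
    · rw [Set.mem_ofPred_eq, hw₀re]
      linarith [min_le_left 0 (P.re - R)]
    · have : {w : ℂ | w.re < P.re - R} ∈ 𝓝 w₀ :=
        (isOpen_lt Complex.continuous_re continuous_const).mem_nhds (by
          rw [Set.mem_ofPred_eq, hw₀re]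
          linarith [min_le_right 0 (P.re - R)])
      filter_upwards [this] with w hw
      exact hfar w hw
  set w : ℕ → ℂ := fun n => ((-(1 / ((n : ℝ) + 1)) : ℝ) : ℂ) with hw
  have hwre (n : ℕ) : (w n).re < 0 := by
    simp only [hw, Complex.ofReal_re]
    have : (0 : ℝ) < 1 / ((n : ℝ) + 1) := by positivity
    linarith
  have hwlim : Tendsto w atTop (𝓝 0) := by
    have := (Complex.continuous_ofReal.tendsto _).comp
      (tendsto_one_div_add_atTop_nhds_zero_nat (𝕜 := ℝ)).neg
    simpa [hw, Function.comp_def] using this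
  have h1 : Tendsto (fun n => N (w n) * V (w n)) atTop
      (𝓝 ((∫ u in Set.Ioi (1 : ℝ), ψ u) * V 0)) :=
    (tendsto_integral_mul_cpow hint (fun n => (hwre n).le) hwlim).mul
      ((hVd.continuous.tendsto 0).comp hwlim)
  have h2 : Tendsto (fun n => N (w n) * V (w n)) atTop (𝓝 (W 0)) := by
    have := (hWd.continuous.tendsto 0).comp hwlim
    refine this.congr fun n => ?_
    exact (hEq (hwre n)).symm
  have := tendsto_nhds_unique h1 h2
  simpa [hV, hW] using this

/-! ### Generalized power series and their derivatives. -/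

/-- A generalized power series `∑ e_k x^{S - μ k}`. -/
noncomputable def rpowSeries (e : ℕ → ℂ) (S : ℂ) (μ : ℝ) (x : ℝ) : ℂ :=
  ∑' k, e k * (x : ℂ) ^ (S - μ * k)

theorem norm_cpow_sub_mul {x : ℝ} (hx : 0 < x) (S : ℂ) (μ : ℝ) (k : ℕ) :
    ‖(x : ℂ) ^ (S - μ * k)‖ = x ^ S.re * (x ^ (-μ)) ^ k := by
  rw [Complex.norm_cpow_eq_rpow_re_of_pos hx, ← Real.rpow_natCast, ← Real.rpow_mul hx.le,
    ← Real.rpow_add hx]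
  congr 1
  simp
  ring

/-- The linear factor is absorbed by passing to some y between x₀ and x. Asking for summability at
every x > x₀ makes the hypothesis reproduce itself, so that differentiation can be iterated. -/
theorem summable_norm_mul_linear {e : ℕ → ℂ} (S : ℂ) {μ x₀ : ℝ} (hx₀ : 0 < x₀) (hμ : 0 < μ)
    (he : ∀ x, x₀ < x → Summable fun k => ‖e k‖ * (x ^ (-μ)) ^ k) (x : ℝ) (hx : x₀ < x) :
    Summable fun k : ℕ => ‖e k * (S - μ * k)‖ * (x ^ (-μ)) ^ k := by
  obtain ⟨y, hy0, hyx⟩ := exists_between hx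
  have hypos : 0 < y := hx₀.trans hy0
  have hxpos : 0 < x := hypos.trans hyx
  set r := x ^ (-μ) / y ^ (-μ) with hr
  have hyμ : 0 < y ^ (-μ) := Real.rpow_pos_of_pos hypos _
  have hr0 : 0 ≤ r := by positivity
  have hr1 : r < 1 := by
    rw [hr, div_lt_one hyμ]
    exact Real.rpow_lt_rpow_of_neg hypos hyx (by linarith)
  have hlim : Tendsto (fun k : ℕ => (‖S‖ + μ * k) * r ^ k) atTop (𝓝 0) := by
    have h1 := (tendsto_pow_atTop_nhds_zero_of_lt_one hr0 hr1).const_mul ‖S‖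
    have h2 := (tendsto_self_mul_const_pow_of_lt_one hr0 hr1).const_mul μ
    have := h1.add h2
    simp only [mul_zero, add_zero] at this
    refine this.congr fun k => ?_
    ring
  obtain ⟨C, hC⟩ := hlim.bddAbove_range
  refine Summable.of_nonneg_of_le (fun k => by positivity) (fun k => ?_) ((he y hy0).mul_left C)
  have hk : (‖S‖ + μ * k) * r ^ k ≤ C := hC ⟨k, rfl⟩
  have hn : ‖S - μ * k‖ ≤ ‖S‖ + μ * k := by
    refine (norm_sub_le _ _).trans_eq ?_
    rw [norm_mul, Complex.norm_real, Real.norm_of_nonneg hμ.le, Complex.norm_natCast]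
  have hxr : (x ^ (-μ)) ^ k = r ^ k * (y ^ (-μ)) ^ k := by
    rw [← mul_pow, hr, div_mul_cancel₀ _ hyμ.ne']
  rw [norm_mul, hxr]
  calc _ ≤ ‖e k‖ * (‖S‖ + μ * k) * (r ^ k * (y ^ (-μ)) ^ k) := by gcongr
    _ = ((‖S‖ + μ * k) * r ^ k) * (‖e k‖ * (y ^ (-μ)) ^ k) := by ring
    _ ≤ _ := by gcongr

theorem hasDerivAt_rpowSeries {e : ℕ → ℂ} (S : ℂ) {μ x₀ : ℝ} (hx₀ : 0 < x₀) (hμ : 0 < μ)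
    (he : ∀ x, x₀ < x → Summable fun k => ‖e k‖ * (x ^ (-μ)) ^ k) {x : ℝ} (hx : x₀ < x) :
    HasDerivAt (rpowSeries e S μ) (rpowSeries (fun k => e k * (S - μ * k)) (S - 1) μ x) x := by
  obtain ⟨y, hy0, hyx⟩ := exists_between hx
  have hypos : 0 < y := hx₀.trans hy0
  have hcont : ContinuousOn (fun t : ℝ => t ^ (S - 1).re) (Set.Icc y (x + 1)) := fun t ht =>
    (Real.continuousAt_rpow_const _ _ (Or.inl (hypos.trans_le ht.1).ne')).continuousWithinAt
  obtain ⟨B, hB⟩ := isCompact_Icc.exists_bound_of_continuousOn hcont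
  have hB0 : 0 ≤ B := (norm_nonneg _).trans (hB x ⟨hyx.le, by linarith⟩)
  refine hasDerivAt_tsum_of_isPreconnected
    (t := Set.Ioo y (x + 1)) (y₀ := x)
    (g := fun (k : ℕ) (t : ℝ) => e k * (t : ℂ) ^ (S - μ * k))
    (g' := fun (k : ℕ) (t : ℝ) => e k * (S - μ * k) * (t : ℂ) ^ (S - 1 - μ * k))
    ((summable_norm_mul_linear S hx₀ hμ he y hy0).mul_left B) isOpen_Ioo
    isPreconnected_Ioo (fun k t ht => ?_) (fun k t ht => ?_)
    ⟨hyx, by linarith⟩ ?_ ⟨hyx, by linarith⟩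
  · have ht0 : 0 < t := hypos.trans ht.1
    have h := (Complex.hasStrictDerivAt_cpow_const (c := S - μ * k)
      (Complex.ofReal_mem_slitPlane.2 ht0)).hasDerivAt.comp_ofReal
    have := h.const_mul (e k)
    rwa [show S - μ * k - 1 = S - 1 - μ * k by ring, ← mul_assoc] at this
  · have ht0 : 0 < t := hypos.trans ht.1
    rw [norm_mul, norm_cpow_sub_mul ht0]
    have h1 : t ^ (S - 1).re ≤ B := (le_abs_self _).trans (hB t ⟨ht.1.le, ht.2.le⟩)
    have h2 : t ^ (-μ) ≤ y ^ (-μ) :=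
      Real.rpow_le_rpow_of_nonpos hypos ht.1.le (by linarith)
    calc _ ≤ ‖e k * (S - μ * k)‖ * (B * (y ^ (-μ)) ^ k) := by gcongr
      _ = _ := by ring
  · have hx0 : 0 < x := hx₀.trans hx
    refine Summable.of_norm ?_
    refine ((he x hx).mul_left (x ^ S.re)).congr fun k => ?_
    rw [norm_mul, norm_cpow_sub_mul hx0]
    ring

theorem contDiffOn_rpowSeries {e : ℕ → ℂ} (S : ℂ) {μ x₀ : ℝ} (hx₀ : 0 < x₀) (hμ : 0 < μ)
    (he : ∀ x, x₀ < x → Summable fun k => ‖e k‖ * (x ^ (-μ)) ^ k) (n : ℕ) :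
    ContDiffOn ℝ n (rpowSeries e S μ) (Set.Ioi x₀) := by
  induction n generalizing e S with
  | zero =>
    exact contDiffOn_zero.2 fun x hx =>
      (hasDerivAt_rpowSeries S hx₀ hμ he hx).continuousAt.continuousWithinAt
  | succ n ih =>
    push_cast
    refine (contDiffOn_succ_iff_deriv_of_isOpen isOpen_Ioi).2 ⟨fun x hx =>
      (hasDerivAt_rpowSeries S hx₀ hμ he hx).differentiableAt.differentiableWithinAt, by simp, ?_⟩
    exact (ih (S - 1) (summable_norm_mul_linear S hx₀ hμ he)).congr fun x hx =>
      (hasDerivAt_rpowSeries S hx₀ hμ he hx).deriv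

/-- The falling factorial of the exponent T is written as (-1)^n (-T)_n; its sign will cancel the
one in the definition of the fractional derivative. -/
theorem iteratedDeriv_rpowSeries {e : ℕ → ℂ} (S : ℂ) {μ x₀ : ℝ} (hx₀ : 0 < x₀) (hμ : 0 < μ)
    (he : ∀ x, x₀ < x → Summable fun k => ‖e k‖ * (x ^ (-μ)) ^ k) (n : ℕ) :
    (∀ x, x₀ < x → iteratedDeriv n (rpowSeries e S μ) x =
      rpowSeries (fun k => e k * ((-1) ^ n * pochhammerC (-(S - μ * k)) n)) (S - n) μ x) ∧
    (∀ x, x₀ < x → Summable fun k : ℕ =>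
      ‖e k * ((-1) ^ n * pochhammerC (-(S - μ * k)) n)‖ * (x ^ (-μ)) ^ k) := by
  induction n with
  | zero => simpa [pochhammerC_zero] using he
  | succ n ih =>
    have hstep (k : ℕ) : e k * ((-1) ^ n * pochhammerC (-(S - μ * k)) n) * (S - n - μ * k) =
        e k * ((-1) ^ (n + 1) * pochhammerC (-(S - μ * k)) (n + 1)) := by
      rw [pochhammerC_succ]
      ring
    refine ⟨fun x hx => ?_, fun x hx => ?_⟩
    · have hev : iteratedDeriv n (rpowSeries e S μ) =ᶠ[𝓝 x]
          rpowSeries (fun k => e k * ((-1) ^ n * pochhammerC (-(S - μ * k)) n)) (S - n) μ := by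
        filter_upwards [Ioi_mem_nhds hx] with t ht using ih.1 t ht
      rw [iteratedDeriv_succ, hev.deriv_eq, (hasDerivAt_rpowSeries (S - n) hx₀ hμ ih.2 hx).deriv]
      simp_rw [hstep]
      congr 1
      push_cast
      ring
    · simpa only [hstep] using summable_norm_mul_linear (S - n) hx₀ hμ ih.2 x hx

/-- Valid also at the poles of Γ, where both sides vanish, so no condition on s is needed. -/
theorem Gamma_inv_eq_pochhammerC_mul (s : ℂ) (n : ℕ) :
    (Complex.Gamma s)⁻¹ = pochhammerC s n * (Complex.Gamma (s + n))⁻¹ := by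
  induction n with
  | zero => simp [pochhammerC_zero]
  | succ n ih =>
    rw [ih, Complex.one_div_Gamma_eq_self_mul_one_div_Gamma_add_one (s + n), pochhammerC_succ]
    push_cast
    ring_nf

/-! ### Integrability of the single terms. -/

/-- On a bounded interval the exponent s is immaterial: changing it multiplies by a function bounded
on [1, U], and for one exponent integrability up to ∞ is known. -/
theorem integrableOn_saigoKernel_Ioc (a a' b b' : ℂ) {c : ℂ} (hc : 0 < c.re) (s : ℂ) (U : ℝ) :
    IntegrableOn (fun u : ℝ => saigoKernel a a' b b' c u * (u : ℂ) ^ s) (Set.Ioc 1 U) := by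
  obtain ⟨E, -, hE⟩ := hasSum_saigoKernel_mellin a a' b b' hc
  set P : ℂ := ((E + 1 : ℝ) : ℂ)
  have h := (hE P (by simp [P])).1
  set s₁ := a + a' - c - P
  have hcont : ContinuousOn (fun u : ℝ => (u : ℂ) ^ (s - s₁)) (Set.Icc 1 U) := fun u hu => by
    have hu0 : (0 : ℝ) < u := one_pos.trans_le hu.1
    exact (Complex.continuousAt_ofReal_cpow_const u _ (Or.inr hu0.ne')).continuousWithinAt
  obtain ⟨B, hB⟩ := isCompact_Icc.exists_bound_of_continuousOn hcont
  have h' := Integrable.mul_bdd (c := B)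
    (h.mono_set Set.Ioc_subset_Ioi_self : IntegrableOn _ (Set.Ioc 1 U))
    (measurable_ofReal_cpow (s - s₁)).aestronglyMeasurable (by
      filter_upwards [ae_restrict_mem measurableSet_Ioc] with u hu
      exact hB u ⟨hu.1.le, hu.2⟩)
  refine IntegrableOn.congr_fun h' (fun u hu => ?_) measurableSet_Ioc
  have hu0 : (u : ℂ) ≠ 0 := by exact_mod_cast (one_pos.trans hu.1).ne'
  rw [mul_assoc, ← Complex.cpow_add _ _ hu0, add_sub_cancel]

theorem aestronglyMeasurable_saigoKernel (a a' b b' : ℂ) {c : ℂ} (hc : 0 < c.re) (s : ℂ) :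
    AEStronglyMeasurable (fun u : ℝ => saigoKernel a a' b b' c u * (u : ℂ) ^ s)
      (volume.restrict (Set.Ioi 1)) := by
  obtain ⟨E, -, hE⟩ := hasSum_saigoKernel_mellin a a' b b' hc
  set P : ℂ := ((E + 1 : ℝ) : ℂ)
  have h := (hE P (by simp [P])).1.aestronglyMeasurable
  set s₁ := a + a' - c - P
  refine (h.mul (measurable_ofReal_cpow (s - s₁)).aestronglyMeasurable).congr ?_
  filter_upwards [ae_restrict_mem measurableSet_Ioi] with u hu
  have hu0 : (u : ℂ) ≠ 0 := by exact_mod_cast (one_pos.trans hu).ne'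
  simp only [Pi.mul_apply]
  rw [mul_assoc, ← Complex.cpow_add _ _ hu0, add_sub_cancel]

theorem exists_norm_tsum_ge {d : ℕ → ℂ} {q₀ : ℝ} (hq₀ : 0 < q₀)
    (hs : Summable fun k => ‖d k‖ * q₀ ^ k) {k₀ : ℕ} (hlow : ∀ k < k₀, d k = 0) (hk₀ : d k₀ ≠ 0) :
    ∃ q₁, 0 < q₁ ∧ ∀ q : ℝ, 0 ≤ q → q ≤ q₁ →
      ‖d k₀‖ / 2 * q ^ k₀ ≤ ‖∑' k, d k * (q : ℂ) ^ k‖ := by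
  have hs' : Summable fun j => ‖d (j + (k₀ + 1))‖ * q₀ ^ j := by
    refine (((summable_nat_add_iff (k₀ + 1)).2 hs).mul_right (q₀ ^ (k₀ + 1))⁻¹).congr fun j => ?_
    rw [pow_add]
    field_simp
  set C := ∑' j, ‖d (j + (k₀ + 1))‖ * q₀ ^ j with hC
  have hC0 : 0 ≤ C := tsum_nonneg fun j => by positivity
  have hd : 0 < ‖d k₀‖ := norm_pos_iff.2 hk₀
  -- Below q₀ the series converges; the second bound makes the tail, at most C * q ^ (k₀ + 1), no
  -- larger than half the leading term.
  refine ⟨min q₀ (‖d k₀‖ / (2 * (C + 1))), lt_min hq₀ (by positivity), fun q hq hq1 => ?_⟩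
  have hqq₀ : q ≤ q₀ := hq1.trans (min_le_left _ _)
  have hqd : q * (2 * (C + 1)) ≤ ‖d k₀‖ :=
    (le_div_iff₀ (by positivity)).1 (hq1.trans (min_le_right _ _))
  have hnorm (k : ℕ) : ‖d k * (q : ℂ) ^ k‖ = ‖d k‖ * q ^ k := by
    rw [norm_mul, norm_pow, Complex.norm_real, Real.norm_of_nonneg hq]
  have hsq : Summable fun k => d k * (q : ℂ) ^ k :=
    Summable.of_norm_bounded hs fun k => by rw [hnorm]; gcongr
  have hsplit := hsq.sum_add_tsum_nat_add (k₀ + 1)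
  have hhead : ∑ k ∈ Finset.range (k₀ + 1), d k * (q : ℂ) ^ k = d k₀ * (q : ℂ) ^ k₀ := by
    rw [Finset.sum_range_succ, Finset.sum_eq_zero, zero_add]
    intro k hk
    rw [hlow k (Finset.mem_range.1 hk), zero_mul]
  have htail : ‖∑' j, d (j + (k₀ + 1)) * (q : ℂ) ^ (j + (k₀ + 1))‖ ≤ C * q ^ (k₀ + 1) := by
    refine tsum_of_norm_bounded (hs'.hasSum.mul_right _) fun j => ?_
    rw [hnorm, pow_add, ← mul_assoc]
    gcongr
  rw [← hsplit, hhead]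
  have h1 := norm_sub_le_norm_add (d k₀ * (q : ℂ) ^ k₀)
    (∑' j, d (j + (k₀ + 1)) * (q : ℂ) ^ (j + (k₀ + 1)))
  rw [hnorm] at h1
  have h2 : C * q ^ (k₀ + 1) ≤ ‖d k₀‖ / 2 * q ^ k₀ := by
    rw [pow_succ, ← mul_assoc, mul_right_comm]
    refine mul_le_mul_of_nonneg_right ?_ (by positivity)
    nlinarith
  linarith

theorem ofReal_rpow_neg_pow {u : ℝ} (hu : 0 < u) (μ : ℝ) (k : ℕ) :
    ((u ^ (-μ) : ℝ) : ℂ) ^ k = (u : ℂ) ^ (-(μ * k) : ℂ) := by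
  rw [Complex.ofReal_cpow hu.le, ← Complex.cpow_nat_mul]
  congr 1
  push_cast
  ring

theorem cpow_mul_rpow_neg_pow {u : ℝ} (hu : 0 < u) (s : ℂ) (μ : ℝ) (k : ℕ) :
    (u : ℂ) ^ s * ((u ^ (-μ) : ℝ) : ℂ) ^ k = (u : ℂ) ^ (s - μ * k) := by
  have hu0 : (u : ℂ) ≠ 0 := by exact_mod_cast hu.ne'
  rw [ofReal_rpow_neg_pow hu, ← Complex.cpow_add _ _ hu0]
  ring_nf

/-- If the kernel times a generalized power series is integrable, so is the kernel times each
term which occurs in the series. -/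
theorem integrableOn_saigoKernel_mul_term (a a' b b' : ℂ) {c : ℂ} (hc : 0 < c.re) {d : ℕ → ℂ}
    {s : ℂ} {μ x₀ x : ℝ} (hμ : 0 < μ) (hx₀ : 0 < x₀) (hx : 0 < x)
    (hs : Summable fun k => ‖d k‖ * (x₀ ^ (-μ)) ^ k)
    (hint : IntegrableOn (fun u : ℝ => saigoKernel a a' b b' c u *
      (((x * u : ℝ) : ℂ) ^ s * ∑' k, d k * (((x * u) ^ (-μ) : ℝ) : ℂ) ^ k)) (Set.Ioi 1)) :
    ∃ I : ℝ, ∀ k, d k ≠ 0 →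
      IntegrableOn (fun u : ℝ => saigoKernel a a' b b' c u * (u : ℂ) ^ (s - μ * k)) (Set.Ioi 1) ∧
      ∫ u in Set.Ioi (1 : ℝ), ‖saigoKernel a a' b b' c u * (u : ℂ) ^ (s - μ * k)‖ ≤ I := by
  classical
  by_cases hd : ∃ k, d k ≠ 0
  swap
  · exact ⟨0, fun k hk => (hd ⟨k, hk⟩).elim⟩
  set k₀ := Nat.find hd
  have hk₀ : d k₀ ≠ 0 := Nat.find_spec hd
  have hlow (k : ℕ) (hk : k < k₀) : d k = 0 := not_not.1 (Nat.find_min hd hk)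
  -- For large u the variable (x u)^(-μ) is below q₁, so the integrable sum dominates its first
  -- nonzero term, up to a constant. A later term carries the extra factor u^(-μ(k - k₀)), of norm
  -- at most 1, so one I serves all k. Nothing is claimed where d k = 0, since such terms leave no
  -- trace in the sum.
  obtain ⟨q₁, hq₁, hq⟩ := exists_norm_tsum_ge (Real.rpow_pos_of_pos hx₀ _) hs hlow hk₀
  have hlim : Tendsto (fun u : ℝ => (x * u) ^ (-μ)) atTop (𝓝 0) :=
    (tendsto_rpow_neg_atTop hμ).comp (tendsto_id.const_mul_atTop hx)
  obtain ⟨U, hU⟩ := eventually_atTop.1 (hlim.eventually (Iic_mem_nhds hq₁))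
  set V := max U 1
  have hdpos : 0 < ‖d k₀‖ := norm_pos_iff.2 hk₀
  have hmain : IntegrableOn
      (fun u : ℝ => saigoKernel a a' b b' c u * (u : ℂ) ^ (s - μ * k₀)) (Set.Ioi 1) := by
    rw [← Set.Ioc_union_Ioi_eq_Ioi (le_max_right U 1 : 1 ≤ V)]
    refine (integrableOn_saigoKernel_Ioc a a' b b' hc _ V).union ?_
    have hsub : Set.Ioi V ⊆ Set.Ioi 1 := Set.Ioi_subset_Ioi (le_max_right U 1)
    refine Integrable.mono' (((hint.mono_set hsub).norm).const_mul
      ((‖d k₀‖ / 2 * x ^ (s - μ * k₀).re)⁻¹))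
      ((aestronglyMeasurable_saigoKernel a a' b b' hc _).mono_set hsub) ?_
    filter_upwards [ae_restrict_mem measurableSet_Ioi] with u hu
    have huV : V < u := hu
    have hu1 : 1 < u := (le_max_right U 1).trans_lt huV
    have hu0 : 0 < u := one_pos.trans hu1
    have hxu : 0 < x * u := mul_pos hx hu0
    have h1 := hq _ (Real.rpow_nonneg hxu.le _) (hU u ((le_max_left U 1).trans huV.le))
    have h2 : ‖((x * u : ℝ) : ℂ) ^ s‖ * ((x * u) ^ (-μ)) ^ k₀ =
        x ^ (s - μ * k₀).re * ‖(u : ℂ) ^ (s - μ * k₀)‖ := by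
      rw [Complex.norm_cpow_eq_rpow_re_of_pos hu0, ← Real.mul_rpow hx.le hu0.le,
        ← Complex.norm_cpow_eq_rpow_re_of_pos hxu, norm_cpow_sub_mul hxu,
        Complex.norm_cpow_eq_rpow_re_of_pos hxu]
    have hxs : 0 < x ^ (s - μ * k₀).re := Real.rpow_pos_of_pos hx _
    rw [inv_mul_eq_div, le_div_iff₀ (by positivity), norm_mul, norm_mul, norm_mul]
    calc _ = ‖saigoKernel a a' b b' c u‖ * (‖d k₀‖ / 2 *
          (x ^ (s - μ * k₀).re * ‖(u : ℂ) ^ (s - μ * k₀)‖)) := by ring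
      _ = ‖saigoKernel a a' b b' c u‖ * (‖((x * u : ℝ) : ℂ) ^ s‖ *
          (‖d k₀‖ / 2 * ((x * u) ^ (-μ)) ^ k₀)) := by rw [← h2]; ring
      _ ≤ _ := by gcongr
  refine ⟨∫ u in Set.Ioi (1 : ℝ), ‖saigoKernel a a' b b' c u * (u : ℂ) ^ (s - μ * k₀)‖,
    fun k hk => ?_⟩
  have hkk : k₀ ≤ k := not_lt.1 fun h => hk (hlow k h)
  have hkk' : (k₀ : ℝ) ≤ k := by exact_mod_cast hkk
  have hre : ((-(μ * ((k : ℝ) - k₀)) : ℝ) : ℂ).re ≤ 0 := by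
    rw [Complex.ofReal_re, neg_nonpos]
    exact mul_nonneg hμ.le (sub_nonneg.2 hkk')
  have hfac {u : ℝ} (hu : 1 < u) : saigoKernel a a' b b' c u * (u : ℂ) ^ (s - μ * k) =
      saigoKernel a a' b b' c u * (u : ℂ) ^ (s - μ * k₀) *
        (u : ℂ) ^ ((-(μ * ((k : ℝ) - k₀)) : ℝ) : ℂ) := by
    have hu0 : (u : ℂ) ≠ 0 := by exact_mod_cast (one_pos.trans hu).ne'
    rw [mul_assoc, ← Complex.cpow_add _ _ hu0]
    congr 2
    push_cast
    ring
  have hik : IntegrableOn (fun u : ℝ => saigoKernel a a' b b' c u * (u : ℂ) ^ (s - μ * k))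
      (Set.Ioi 1) :=
    (integrableOn_mul_cpow hmain hre).congr_fun (fun u hu => (hfac hu).symm) measurableSet_Ioi
  refine ⟨hik, setIntegral_mono_on hik.norm hmain.norm measurableSet_Ioi fun u hu => ?_⟩
  rw [hfac hu, norm_mul _ ((u : ℂ) ^ _)]
  exact mul_le_of_le_one_right (norm_nonneg _) (norm_ofReal_cpow_le_one hu hre)

/-! ### Termwise fractional integration and differentiation. -/

/-- Homogeneity: after t = xu the kernel no longer depends on x. Hence integrability of the terms,
obtained at z, holds for every x. -/
theorem saigoMaedaIntegrandRight_mul (a a' b b' c : ℂ) (f : ℝ → ℂ) {x u : ℝ} (hx : 0 < x)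
    (hu : 1 < u) :
    saigoMaedaIntegrandRight a a' b b' c f x (x * u) =
      (x : ℂ) ^ (c - 1 - a) * (saigoKernel a a' b b' c u * f (x * u)) := by
  have hx0 : (x : ℂ) ≠ 0 := by exact_mod_cast hx.ne'
  have hu0 : 0 < u := by linarith
  have e1 : x * u - x = x * (u - 1) := by ring
  have e2 : x / (x * u) = 1 / u := by field_simp
  have e3 : x * u / x = u := by field_simp
  rw [saigoMaedaIntegrandRight, saigoKernel, e1, e2, e3, Complex.ofReal_mul, Complex.ofReal_mul,
    Complex.mul_cpow_ofReal_nonneg hx.le (by linarith),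
    Complex.mul_cpow_ofReal_nonneg hx.le hu0.le, sub_eq_add_neg (c - 1) a,
    Complex.cpow_add _ _ hx0]
  ring

/-- Termwise integration of a generalized power series. -/
theorem saigoMaedaIntegralRight_series (a a' b b' : ℂ) {c : ℂ} {d : ℕ → ℂ}
    {s : ℂ} {μ x I : ℝ} (hx : 0 < x)
    (hs : Summable fun k => ‖d k‖ * (x ^ (-μ)) ^ k)
    (hI : ∀ k, d k ≠ 0 →
      IntegrableOn (fun u : ℝ => saigoKernel a a' b b' c u * (u : ℂ) ^ (s - μ * k)) (Set.Ioi 1) ∧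
      ∫ u in Set.Ioi (1 : ℝ), ‖saigoKernel a a' b b' c u * (u : ℂ) ^ (s - μ * k)‖ ≤ I) :
    saigoMaedaIntegralRight a a' b b' c
      (fun t : ℝ => (t : ℂ) ^ s * ∑' k, d k * ((t ^ (-μ) : ℝ) : ℂ) ^ k) x =
      rpowSeries (fun k => d k * (∫ u in Set.Ioi (1 : ℝ),
        saigoKernel a a' b b' c u * (u : ℂ) ^ (s - μ * k)) / Complex.Gamma c)
        (s + c - a - a') μ x := by
  set f : ℝ → ℂ := fun t => (t : ℂ) ^ s * ∑' k, d k * ((t ^ (-μ) : ℝ) : ℂ) ^ k with hf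
  set M : ℕ → ℂ := fun k => ∫ u in Set.Ioi (1 : ℝ),
    saigoKernel a a' b b' c u * (u : ℂ) ^ (s - μ * k) with hM
  have hx0 : (x : ℂ) ≠ 0 := by exact_mod_cast hx.ne'
  set q : ℂ := ((x ^ (-μ) : ℝ) : ℂ) with hq
  have hqn : ‖q‖ = x ^ (-μ) := by
    rw [hq, Complex.norm_real, Real.norm_of_nonneg (Real.rpow_nonneg hx.le _)]
  set F : ℕ → ℝ → ℂ := fun k u =>
    d k * q ^ k * (saigoKernel a a' b b' c u * (u : ℂ) ^ (s - μ * k)) with hF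
  have hFint (k : ℕ) : IntegrableOn (F k) (Set.Ioi 1) := by
    by_cases hk : d k = 0
    · simp [hF, hk]
    · exact (hI k hk).1.const_mul _
  have hFsum : Summable fun k => ∫ u in Set.Ioi (1 : ℝ), ‖F k u‖ := by
    refine Summable.of_nonneg_of_le (fun k => integral_nonneg fun u => norm_nonneg _)
      (fun k => ?_) (hs.mul_right I)
    by_cases hk : d k = 0
    · simp [hF, hk]
    · simp only [hF]
      simp_rw [norm_mul (d k * q ^ k)]
      rw [integral_const_mul, norm_mul, norm_pow, hqn]
      exact mul_le_mul_of_nonneg_left (hI k hk).2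
        (mul_nonneg (norm_nonneg _) (pow_nonneg (Real.rpow_nonneg hx.le _) _))
  have hsum := integral_tsum_of_summable_integral_norm hFint hFsum
  have hpt {u : ℝ} (hu : 1 < u) :
      saigoMaedaIntegrandRight a a' b b' c f x (x * u) =
        (x : ℂ) ^ (c - 1 - a) * (x : ℂ) ^ s * ∑' k, F k u := by
    have hu0 : 0 < u := by linarith
    rw [saigoMaedaIntegrandRight_mul a a' b b' c f hx hu, hf]
    simp only [hF]
    rw [Complex.ofReal_mul, Complex.mul_cpow_ofReal_nonneg hx.le hu0.le,
      Real.mul_rpow hx.le hu0.le]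
    have : ∑' k, d k * q ^ k * (saigoKernel a a' b b' c u * (u : ℂ) ^ (s - μ * k)) =
        saigoKernel a a' b b' c u * (u : ℂ) ^ s *
          ∑' k, d k * ((x ^ (-μ) * u ^ (-μ) : ℝ) : ℂ) ^ k := by
      rw [← tsum_mul_left]
      refine tsum_congr fun k => ?_
      rw [← cpow_mul_rpow_neg_pow hu0, Complex.ofReal_mul, mul_pow]
      ring
    rw [this]
    ring
  have hscale : ∫ t in Set.Ioi x, saigoMaedaIntegrandRight a a' b b' c f x t =
      x * ∫ u in Set.Ioi (1 : ℝ), saigoMaedaIntegrandRight a a' b b' c f x (x * u) := by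
    rw [integral_comp_mul_left_Ioi _ _ hx, mul_one, Complex.real_smul, ← mul_assoc,
      Complex.ofReal_inv, mul_inv_cancel₀ hx0, one_mul]
  rw [saigoMaedaIntegralRight, hscale, setIntegral_congr_fun measurableSet_Ioi fun u hu => hpt hu,
    integral_const_mul, ← hsum, rpowSeries, ← tsum_mul_left, ← tsum_mul_left, ← tsum_mul_left]
  refine tsum_congr fun k => ?_
  simp only [hF]
  rw [integral_const_mul, ← cpow_mul_rpow_neg_pow hx (s + c - a - a'),
    show s + c - a - a' = -a' + 1 + (c - 1 - a) + s by ring, Complex.cpow_add _ _ hx0,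
    Complex.cpow_add _ _ hx0, Complex.cpow_add _ _ hx0, Complex.cpow_one]
  ring

/-- The quotient of Gamma functions by which the fractional derivative multiplies
`t^{σ - μ k - 1}`. -/
noncomputable def derivRightFactor (α α' β β' γ σ : ℂ) (μ : ℝ) (k : ℕ) : ℂ :=
  Complex.Gamma (1 - α - α' + γ - σ + μ * k) * Complex.Gamma (1 - α' - β + γ - σ + μ * k) *
      Complex.Gamma (1 + β' - σ + μ * k) /
    (Complex.Gamma (1 - σ + μ * k) * Complex.Gamma (1 - α - α' - β + γ - σ + μ * k) *
      Complex.Gamma (1 - α' + β' - σ + μ * k))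

theorem re_neg_add_saigoMaedaOrder_pos (γ : ℂ) : 0 < (-γ + (saigoMaedaOrder γ : ℂ)).re := by
  have := Nat.lt_floor_add_one γ.re
  simp only [saigoMaedaOrder, Complex.add_re, Complex.neg_re, Complex.natCast_re]
  push_cast
  linarith

theorem hasSum_saigoMaedaDerivRight_series {α α' β β' γ σ : ℂ} {μ z : ℝ} {d : ℕ → ℂ}
    (hμ : 0 < μ) (hz : 0 < z)
    (h₁ : ∀ n k : ℕ, 1 - α - α' + γ - σ + μ * n ≠ -(k : ℂ))
    (h₂ : ∀ n k : ℕ, 1 - α' - β + γ - σ + μ * n ≠ -(k : ℂ))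
    (h₃ : ∀ n k : ℕ, 1 + β' - σ + μ * n ≠ -(k : ℂ))
    (hs : ∀ᶠ x in 𝓝 z, Summable fun k => d k * ((x ^ (-μ) : ℝ) : ℂ) ^ k)
    (hconv : SaigoMaedaPrederivRightConverges α α' β β' γ
      (fun t : ℝ => (t : ℂ) ^ (σ - 1) * ∑' k, d k * ((t ^ (-μ) : ℝ) : ℂ) ^ k) z) :
    ContDiffAt ℝ (saigoMaedaOrder γ) (saigoMaedaPrederivRight α α' β β' γ
      (fun t : ℝ => (t : ℂ) ^ (σ - 1) * ∑' k, d k * ((t ^ (-μ) : ℝ) : ℂ) ^ k)) z ∧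
    HasSum (fun k => (z : ℂ) ^ (σ + α + α' - γ - 1) *
        (d k * ((z ^ (-μ) : ℝ) : ℂ) ^ k * derivRightFactor α α' β β' γ σ μ k))
      (saigoMaedaDerivRight α α' β β' γ
        (fun t : ℝ => (t : ℂ) ^ (σ - 1) * ∑' k, d k * ((t ^ (-μ) : ℝ) : ℂ) ^ k) z) := by
  set n := saigoMaedaOrder γ with hn
  set f : ℝ → ℂ := fun t : ℝ => (t : ℂ) ^ (σ - 1) * ∑' k, d k * ((t ^ (-μ) : ℝ) : ℂ) ^ k with hf
  set c : ℂ := -γ + n with hcdef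
  have hc : 0 < c.re := re_neg_add_saigoMaedaOrder_pos γ
  -- A point to the left of z, so that (x₀, ∞) is a neighbourhood of z; the series converges
  -- throughout it because x^(-μ) decreases.
  obtain ⟨x₀, ⟨hx₀, hx₀z⟩, hx₀s⟩ : ∃ x₀ : ℝ, (0 < x₀ ∧ x₀ < z) ∧
      Summable fun k => d k * ((x₀ ^ (-μ) : ℝ) : ℂ) ^ k := by
    have h1 : ∀ᶠ x in 𝓝[<] z, Summable fun k => d k * ((x ^ (-μ) : ℝ) : ℂ) ^ k :=
      hs.filter_mono nhdsWithin_le_nhds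
    have h2 : ∀ᶠ x in 𝓝[<] z, 0 < x ∧ x < z := Ioo_mem_nhdsLT hz
    exact (h2.and h1).exists
  have hnorm {x : ℝ} (hx : 0 < x) (k : ℕ) :
      ‖d k * ((x ^ (-μ) : ℝ) : ℂ) ^ k‖ = ‖d k‖ * (x ^ (-μ)) ^ k := by
    rw [norm_mul, norm_pow, Complex.norm_real, Real.norm_of_nonneg (Real.rpow_nonneg hx.le _)]
  have hs₀ : Summable fun k => ‖d k‖ * (x₀ ^ (-μ)) ^ k :=
    hx₀s.norm.congr fun k => hnorm hx₀ k
  have hsx (x : ℝ) (hx : x₀ < x) : Summable fun k => ‖d k‖ * (x ^ (-μ)) ^ k := by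
    have hx' : 0 < x := hx₀.trans hx
    refine Summable.of_nonneg_of_le (fun k => by positivity) (fun k => ?_) hs₀
    have := Real.rpow_le_rpow_of_nonpos hx₀ hx.le (by linarith : -μ ≤ 0)
    gcongr
  have hint : IntegrableOn (fun u : ℝ => saigoKernel (-α') (-α) (-β') (-β + n) c u * f (z * u))
      (Set.Ioi 1) := by
    have hconv' : IntegrableOn (saigoMaedaIntegrandRight (-α') (-α) (-β') (-β + n) c f z)
        (Set.Ioi z) := hconv
    have h1 := (integrableOn_Ioi_comp_mul_left_iff
      (saigoMaedaIntegrandRight (-α') (-α) (-β') (-β + n) c f z) 1 hz).2 (by rwa [mul_one])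
    have hz0 : (z : ℂ) ≠ 0 := by exact_mod_cast hz.ne'
    have hpow : (z : ℂ) ^ (c - 1 - -α') ≠ 0 := by simp [Complex.cpow_eq_zero_iff, hz0]
    refine IntegrableOn.congr_fun (h1.const_mul ((z : ℂ) ^ (c - 1 - -α'))⁻¹) (fun u hu => ?_)
      measurableSet_Ioi
    rw [saigoMaedaIntegrandRight_mul _ _ _ _ _ _ hz hu, inv_mul_cancel_left₀ hpow]
  obtain ⟨I, hI⟩ := integrableOn_saigoKernel_mul_term (-α') (-α) (-β') (-β + n) hc hμ hx₀ hz hs₀ hint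
  set M : ℕ → ℂ := fun k => ∫ u in Set.Ioi (1 : ℝ),
    saigoKernel (-α') (-α) (-β') (-β + n) c u * (u : ℂ) ^ (σ - 1 - μ * k) with hM
  set e : ℕ → ℂ := fun k => d k * M k / Complex.Gamma c with he
  set S : ℂ := σ - 1 + c - -α' - -α with hS
  have hpre (x : ℝ) (hx : x₀ < x) :
      saigoMaedaPrederivRight α α' β β' γ f x = rpowSeries e S μ x :=
    saigoMaedaIntegralRight_series (-α') (-α) (-β') (-β + n) (hx₀.trans hx) (hsx x hx) hI
  have hes (x : ℝ) (hx : x₀ < x) : Summable fun k => ‖e k‖ * (x ^ (-μ)) ^ k := by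
    have hx' : 0 < x := hx₀.trans hx
    refine Summable.of_nonneg_of_le (fun k => by positivity) (fun k => ?_)
      ((hsx x hx).mul_left (I / ‖Complex.Gamma c‖))
    by_cases hk : d k = 0
    · simp [he, hk]
    · have : ‖M k‖ ≤ I := (norm_integral_le_integral_norm _).trans (hI k hk).2
      simp only [he]
      rw [norm_div, norm_mul]
      calc _ ≤ ‖d k‖ * I / ‖Complex.Gamma c‖ * (x ^ (-μ)) ^ k := by gcongr
        _ = _ := by ring
  have hev : saigoMaedaPrederivRight α α' β β' γ f =ᶠ[𝓝 z] rpowSeries e S μ := by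
    filter_upwards [Ioi_mem_nhds hx₀z] with x hx using hpre x hx
  obtain ⟨hder, hdsum⟩ := iteratedDeriv_rpowSeries S hx₀ hμ hes n
  refine ⟨((contDiffOn_rpowSeries S hx₀ hμ hes n).contDiffAt
    (Ioi_mem_nhds hx₀z)).congr_of_eventuallyEq hev, ?_⟩
  -- With P = -(S - μk), the factor (P)_n from the derivatives is exactly what changes 1/Γ(P) into
  -- 1/Γ(P + n). There is no division by 1/Γ(P), which may vanish; only Γ(P + n), finite by `h₁`, is
  -- moved across.
  have hfac (k : ℕ) (hk : d k ≠ 0) : pochhammerC (-(S - μ * k)) n * (M k / Complex.Gamma c) =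
      derivRightFactor α α' β β' γ σ μ k := by
    have hexp : -α' + -α - c - -(S - μ * k) = σ - 1 - μ * k := by rw [hS]; ring
    have h := integral_saigoKernel_of_integrableOn (-α') (-α) (-β') (-β + n) hc
      (P := -(S - μ * k)) rfl (by rw [hexp]; exact (hI k hk).1)
    rw [hexp, Gamma_inv_eq_pochhammerC_mul (-(S - μ * k)) n,
      show -(S - μ * k) + c - -α - -α' = 1 - σ + μ * k by rw [hS]; ring,
      show -(S - μ * k) + n = 1 - α - α' + γ - σ + μ * k by rw [hS, hcdef]; ring,
      show -(S - μ * k) + c - -α - c + (-β + n) = 1 - α' - β + γ - σ + μ * k by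
        rw [hS, hcdef]; ring,
      show 1 - σ + μ * k - -β' = 1 + β' - σ + μ * k by ring,
      show -(S - μ * k) + c - c + (-β + n) = 1 - α - α' - β + γ - σ + μ * k by
        rw [hS, hcdef]; ring,
      show -(S - μ * k) + c - -α - -β' = 1 - α' + β' - σ + μ * k by rw [hS]; ring] at h
    have g1 := Complex.Gamma_ne_zero (h₁ k)
    have g2 := Complex.Gamma_ne_zero (h₂ k)
    have g3 := Complex.Gamma_ne_zero (h₃ k)
    have g4 := Complex.Gamma_ne_zero_of_re_pos hc
    change M k * _ = _ at h
    rw [derivRightFactor, div_eq_mul_inv _ (_ * _ * _), mul_inv, mul_inv]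
    have h' : M k * pochhammerC (-(S - μ * k)) n =
        Complex.Gamma (1 - α - α' + γ - σ + μ * k) * Complex.Gamma (1 - α' - β + γ - σ + μ * k) *
        Complex.Gamma (1 + β' - σ + μ * k) * (M k * (pochhammerC (-(S - μ * k)) n *
          (Complex.Gamma (1 - α - α' + γ - σ + μ * k))⁻¹ *
          (Complex.Gamma (1 - α' - β + γ - σ + μ * k))⁻¹ *
          (Complex.Gamma (1 + β' - σ + μ * k))⁻¹)) := by
      field_simp
    rw [mul_div_assoc', mul_comm _ (M k), h', h, div_eq_iff g4]
    ring
  have hterm (k : ℕ) : (-1) ^ n * (e k * ((-1) ^ n * pochhammerC (-(S - μ * k)) n) *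
      (z : ℂ) ^ (S - n - μ * k)) = (z : ℂ) ^ (σ + α + α' - γ - 1) *
        (d k * ((z ^ (-μ) : ℝ) : ℂ) ^ k * derivRightFactor α α' β β' γ σ μ k) := by
    by_cases hk : d k = 0
    · simp [he, hk]
    · rw [← hfac k hk, ← cpow_mul_rpow_neg_pow hz,
        show S - n = σ + α + α' - γ - 1 by rw [hS, hcdef]; ring]
      have h1 : ((-1 : ℂ) ^ n) * (-1) ^ n = 1 := by rw [← mul_pow]; simp
      simp only [he]
      linear_combination (d k * M k / Complex.Gamma c * pochhammerC (-(S - μ * k)) n *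
        ((z : ℂ) ^ (σ + α + α' - γ - 1) * ((z ^ (-μ) : ℝ) : ℂ) ^ k)) * h1
  have hval : saigoMaedaDerivRight α α' β β' γ f z = (-1) ^ n * rpowSeries
      (fun k => e k * ((-1) ^ n * pochhammerC (-(S - μ * k)) n)) (S - n) μ z := by
    rw [saigoMaedaDerivRight, ← hn, hev.iteratedDeriv_eq, hder z hx₀z]
  have hsumz : Summable fun k : ℕ => e k * ((-1) ^ n * pochhammerC (-(S - μ * k)) n) *
      (z : ℂ) ^ (S - n - μ * k) := by
    refine Summable.of_norm (((hdsum z hx₀z).mul_left (z ^ (S - n).re)).congr fun k => ?_)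
    rw [norm_mul _ ((z : ℂ) ^ _), norm_cpow_sub_mul hz]
    ring
  rw [hval]
  exact (hsumz.hasSum.mul_left ((-1) ^ n)).congr_fun fun k => (hterm k).symm

/-! ### Identification with the Fox–Wright series, and the two formulas. -/

theorem prod_Gamma_add_natCast {p : ℕ} {a : Fin p → ℂ} (ha : ∀ i, ∀ k : ℕ, a i ≠ -(k : ℂ)) (n : ℕ) :
    ∏ i, Complex.Gamma (a i + 1 * n) =
      (∏ i, pochhammerC (a i) n) * ∏ i, Complex.Gamma (a i) := by
  rw [← Finset.prod_mul_distrib]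
  exact Finset.prod_congr rfl fun i _ => by rw [one_mul, Gamma_add_natCast (ha i)]

theorem prod_Gamma_ne_zero {p : ℕ} {a : Fin p → ℂ} (ha : ∀ i, ∀ k : ℕ, a i ≠ -(k : ℂ)) :
    ∏ i, Complex.Gamma (a i) ≠ 0 :=
  Finset.prod_ne_zero_iff.2 fun i _ => Complex.Gamma_ne_zero (ha i)

theorem foxWrightTerm_derivRight {p q : ℕ} {a : Fin p → ℂ} {b : Fin q → ℂ}
    (ha : ∀ i, ∀ k : ℕ, a i ≠ -(k : ℂ)) (hb : ∀ j, ∀ k : ℕ, b j ≠ -(k : ℂ))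
    (α α' β β' γ σ η ξ : ℂ) {ν : ℂ} (hν : 0 < ν.re) (μ : ℝ) (w : ℂ) (k : ℕ) :
    foxWrightTerm (derivRightUpper a α α' β β' γ σ ν μ) (derivRightLower b α α' β β' γ σ η ξ μ) w k =
      (∏ i, Complex.Gamma (a i)) / (∏ j, Complex.Gamma (b j)) * Complex.Gamma ν *
        (kFunctionTerm ξ η ν a b w k * derivRightFactor α α' β β' γ σ μ k) := by
  have hA : ∏ i, Complex.Gamma ((derivRightUpper a α α' β β' γ σ ν μ i).1 +
      (derivRightUpper a α α' β β' γ σ ν μ i).2 * k) =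
      ((∏ i, pochhammerC (a i) k) * ∏ i, Complex.Gamma (a i)) *
      (Complex.Gamma (1 - α - α' + γ - σ + μ * k) * Complex.Gamma (1 - α' - β + γ - σ + μ * k) *
      Complex.Gamma (1 + β' - σ + μ * k) * (pochhammerC ν k * Complex.Gamma ν)) := by
    rw [Fin.prod_univ_add, ← prod_Gamma_add_natCast ha,
      ← Gamma_add_natCast (ne_neg_natCast_of_re_pos hν)]
    simp [derivRightUpper, Fin.prod_univ_four]
  have hB : ∏ i, Complex.Gamma ((derivRightLower b α α' β β' γ σ η ξ μ i).1 +
      (derivRightLower b α α' β β' γ σ η ξ μ i).2 * k) =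
      ((∏ i, pochhammerC (b i) k) * ∏ i, Complex.Gamma (b i)) *
      (Complex.Gamma (1 - σ + μ * k) * Complex.Gamma (1 - α - α' - β + γ - σ + μ * k) *
      Complex.Gamma (1 - α' + β' - σ + μ * k) * Complex.Gamma (ξ * k + η)) := by
    rw [Fin.prod_univ_add, ← prod_Gamma_add_natCast hb, add_comm (ξ * k) η]
    simp [derivRightLower, Fin.prod_univ_four]
  rw [foxWrightTerm, hA, hB, kFunctionTerm, derivRightFactor]
  simp only [div_eq_mul_inv, mul_inv]
  ring

theorem mSeriesTerm_eq_kFunctionTerm {p q : ℕ} (ξ η : ℂ) (a : Fin p → ℂ) (b : Fin q → ℂ) (w : ℂ) :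
    mSeriesTerm ξ η a b w = kFunctionTerm ξ η 1 a b w := by
  funext n
  have : (n.factorial : ℂ) ≠ 0 := by exact_mod_cast n.factorial_ne_zero
  rw [mSeriesTerm, kFunctionTerm, pochhammerC_one]
  simp only [div_eq_mul_inv]
  field_simp

theorem mSeries_eq_kFunction {p q : ℕ} (ξ η : ℂ) (a : Fin p → ℂ) (b : Fin q → ℂ) (w : ℂ) :
    mSeries ξ η a b w = kFunction ξ η 1 a b w := by
  rw [mSeries, kFunction, mSeriesTerm_eq_kFunctionTerm]

theorem kFunctionTerm_ofReal_mul {p q : ℕ} (ξ η ν : ℂ) (a : Fin p → ℂ) (b : Fin q → ℂ) (c y : ℝ)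
    (k : ℕ) : kFunctionTerm ξ η ν a b ((c * y : ℝ) : ℂ) k =
      kFunctionTerm ξ η ν a b c k * (y : ℂ) ^ k := by
  rw [kFunctionTerm, kFunctionTerm, Complex.ofReal_mul, mul_pow]
  ring

theorem saigoMaedaDerivRight_kFunction {p q : ℕ} {a : Fin p → ℂ} {b : Fin q → ℂ}
    {α α' β β' γ η ν ξ σ : ℂ} {μ c z : ℝ}
    (hν : 0 < ν.re) (hμ : 0 < μ) (hz : 0 < z)
    (hb : ∀ j, ∀ k : ℕ, b j ≠ -(k : ℂ))
    (ha : ∀ i, ∀ k : ℕ, a i ≠ -(k : ℂ))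
    (h₁ : ∀ n k : ℕ, 1 - α - α' + γ - σ + μ * n ≠ -(k : ℂ))
    (h₂ : ∀ n k : ℕ, 1 - α' - β + γ - σ + μ * n ≠ -(k : ℂ))
    (h₃ : ∀ n k : ℕ, 1 + β' - σ + μ * n ≠ -(k : ℂ))
    (hs : ∀ᶠ x in 𝓝 z, Summable (kFunctionTerm ξ η ν a b ((c * x ^ (-μ) : ℝ) : ℂ)))
    (hconv : SaigoMaedaPrederivRightConverges α α' β β' γ
        (fun t : ℝ => (t : ℂ) ^ (σ - 1) * kFunction ξ η ν a b ((c * t ^ (-μ) : ℝ) : ℂ)) z) :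
    ContDiffAt ℝ (saigoMaedaOrder γ) (saigoMaedaPrederivRight α α' β β' γ
        (fun t : ℝ => (t : ℂ) ^ (σ - 1) * kFunction ξ η ν a b ((c * t ^ (-μ) : ℝ) : ℂ))) z ∧
      Summable (foxWrightTerm (derivRightUpper a α α' β β' γ σ ν μ)
        (derivRightLower b α α' β β' γ σ η ξ μ) ((c * z ^ (-μ) : ℝ) : ℂ)) ∧
      saigoMaedaDerivRight α α' β β' γ
          (fun t : ℝ => (t : ℂ) ^ (σ - 1) * kFunction ξ η ν a b ((c * t ^ (-μ) : ℝ) : ℂ)) z =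
        (∏ j, Complex.Gamma (b j)) / (∏ i, Complex.Gamma (a i)) *
          ((z : ℂ) ^ (σ + α + α' - γ - 1) / Complex.Gamma ν) *
          foxWright (derivRightUpper a α α' β β' γ σ ν μ)
            (derivRightLower b α α' β β' γ σ η ξ μ) ((c * z ^ (-μ) : ℝ) : ℂ) := by
  have hfun : (fun t : ℝ => (t : ℂ) ^ (σ - 1) * kFunction ξ η ν a b ((c * t ^ (-μ) : ℝ) : ℂ)) =
      fun t : ℝ => (t : ℂ) ^ (σ - 1) *
        ∑' k, kFunctionTerm ξ η ν a b c k * ((t ^ (-μ) : ℝ) : ℂ) ^ k := by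
    funext t
    rw [kFunction]
    simp_rw [kFunctionTerm_ofReal_mul]
  rw [hfun] at hconv ⊢
  obtain ⟨hcd, hsum⟩ := hasSum_saigoMaedaDerivRight_series hμ hz h₁ h₂ h₃
    (hs.mono fun x hx => hx.congr fun k => kFunctionTerm_ofReal_mul ξ η ν a b c _ k) hconv
  have hz0 : (z : ℂ) ≠ 0 := by exact_mod_cast hz.ne'
  have hpow : (z : ℂ) ^ (σ + α + α' - γ - 1) ≠ 0 := by simp [Complex.cpow_eq_zero_iff, hz0]
  have hΓa := prod_Gamma_ne_zero ha
  have hΓb := prod_Gamma_ne_zero hb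
  have hΓν := Complex.Gamma_ne_zero_of_re_pos hν
  set C : ℂ := (∏ j, Complex.Gamma (b j)) / (∏ i, Complex.Gamma (a i)) *
    ((z : ℂ) ^ (σ + α + α' - γ - 1) / Complex.Gamma ν) with hC
  have hC0 : C ≠ 0 := mul_ne_zero (div_ne_zero hΓb hΓa) (div_ne_zero hpow hΓν)
  have hterm (k : ℕ) : C * foxWrightTerm (derivRightUpper a α α' β β' γ σ ν μ)
        (derivRightLower b α α' β β' γ σ η ξ μ) ((c * z ^ (-μ) : ℝ) : ℂ) k =
      (z : ℂ) ^ (σ + α + α' - γ - 1) * (kFunctionTerm ξ η ν a b c k *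
        ((z ^ (-μ) : ℝ) : ℂ) ^ k * derivRightFactor α α' β β' γ σ μ k) := by
    rw [foxWrightTerm_derivRight ha hb _ _ _ _ _ _ _ _ hν, kFunctionTerm_ofReal_mul, hC]
    field_simp
  have hsum' := hsum.congr_fun hterm
  -- As C ≠ 0, convergence of the Fox–Wright series follows from that of the differentiated series;
  -- it is not a separate estimate.
  have hsm := (summable_mul_left_iff hC0).1 hsum'.summable
  refine ⟨hcd, hsm, ?_⟩
  rw [foxWright, ← tsum_mul_left]
  exact hsum'.tsum_eq.symm

theorem mainTheorem9 (p q : ℕ) (a : Fin p → ℂ) (b : Fin q → ℂ)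
    (α α' β β' γ η ν ξ σ : ℂ) (μ c z : ℝ)
    (hν : 0 < ν.re) (hξ : 0 < ξ.re) (hγ : 0 < γ.re) (hμ : 0 < μ) (hz : 0 < z)
    -- no lower parameter `b_j`, and no Gamma factor in a numerator on the right, is at a pole
    (hb : ∀ j, ∀ k : ℕ, b j ≠ -(k : ℂ))
    (ha : ∀ i, ∀ k : ℕ, a i ≠ -(k : ℂ))
    (h₁ : ∀ n k : ℕ, 1 - α - α' + γ - σ + μ * n ≠ -(k : ℂ))
    (h₂ : ∀ n k : ℕ, 1 - α' - β + γ - σ + μ * n ≠ -(k : ℂ))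
    (h₃ : ∀ n k : ℕ, 1 + β' - σ + μ * n ≠ -(k : ℂ)) :
    -- the formula for the `M`-series
    ((∀ᶠ x in 𝓝 z, Summable (mSeriesTerm ξ η a b ((c * x ^ (-μ) : ℝ) : ℂ))) →
      (∀ᶠ x in 𝓝 z, SaigoMaedaPrederivRightConverges α α' β β' γ
        (fun t : ℝ => (t : ℂ) ^ (σ - 1) * mSeries ξ η a b ((c * t ^ (-μ) : ℝ) : ℂ)) x) →
      ContDiffAt ℝ (saigoMaedaOrder γ) (saigoMaedaPrederivRight α α' β β' γ
        (fun t : ℝ => (t : ℂ) ^ (σ - 1) * mSeries ξ η a b ((c * t ^ (-μ) : ℝ) : ℂ))) z ∧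
      Summable (foxWrightTerm (derivRightUpper a α α' β β' γ σ 1 μ)
        (derivRightLower b α α' β β' γ σ η ξ μ) ((c * z ^ (-μ) : ℝ) : ℂ)) ∧
      saigoMaedaDerivRight α α' β β' γ
          (fun t : ℝ => (t : ℂ) ^ (σ - 1) * mSeries ξ η a b ((c * t ^ (-μ) : ℝ) : ℂ)) z =
        (∏ j, Complex.Gamma (b j)) / (∏ i, Complex.Gamma (a i)) *
          (z : ℂ) ^ (σ + α + α' - γ - 1) *
          foxWright (derivRightUpper a α α' β β' γ σ 1 μ)
            (derivRightLower b α α' β β' γ σ η ξ μ) ((c * z ^ (-μ) : ℝ) : ℂ)) ∧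
    -- the formula for the `K`-function
    ((∀ᶠ x in 𝓝 z, Summable (kFunctionTerm ξ η ν a b ((c * x ^ (-μ) : ℝ) : ℂ))) →
      (∀ᶠ x in 𝓝 z, SaigoMaedaPrederivRightConverges α α' β β' γ
        (fun t : ℝ => (t : ℂ) ^ (σ - 1) * kFunction ξ η ν a b ((c * t ^ (-μ) : ℝ) : ℂ)) x) →
      ContDiffAt ℝ (saigoMaedaOrder γ) (saigoMaedaPrederivRight α α' β β' γ
        (fun t : ℝ => (t : ℂ) ^ (σ - 1) * kFunction ξ η ν a b ((c * t ^ (-μ) : ℝ) : ℂ))) z ∧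
      Summable (foxWrightTerm (derivRightUpper a α α' β β' γ σ ν μ)
        (derivRightLower b α α' β β' γ σ η ξ μ) ((c * z ^ (-μ) : ℝ) : ℂ)) ∧
      saigoMaedaDerivRight α α' β β' γ
          (fun t : ℝ => (t : ℂ) ^ (σ - 1) * kFunction ξ η ν a b ((c * t ^ (-μ) : ℝ) : ℂ)) z =
        (∏ j, Complex.Gamma (b j)) / (∏ i, Complex.Gamma (a i)) *
          ((z : ℂ) ^ (σ + α + α' - γ - 1) / Complex.Gamma ν) *
          foxWright (derivRightUpper a α α' β β' γ σ ν μ)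
            (derivRightLower b α α' β β' γ σ η ξ μ) ((c * z ^ (-μ) : ℝ) : ℂ)) := by
  refine ⟨fun hs hconv => ?_, fun hs hconv =>
    saigoMaedaDerivRight_kFunction hν hμ hz hb ha h₁ h₂ h₃ hs hconv.self_of_nhds⟩
  -- For ν = 1 the symbol (1)_n cancels n!, so the first formula is a case of the second, with Γ(1)
  -- = 1.
  simp only [mSeries_eq_kFunction, mSeriesTerm_eq_kFunctionTerm] at hs hconv ⊢
  have h := saigoMaedaDerivRight_kFunction (by simp) hμ hz hb ha h₁ h₂ h₃ hs hconv.self_of_nhds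
  rwa [Complex.Gamma_one, div_one] at h
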